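/- **Proposition 2 (Explicit form of covariate-driven deformation, general monotonic).** Let $\mathcal S$ and $\mathcal W$ be smooth, compact, oriented $n$-dimensional manifolds (without boundary), let $\mathcal W$ carry a smooth Riemannian metric, and let $f_0:\mathcal S\to\mathcal W$ be an orientation-preserving $C^1$-diffeomorphism (the baseline deformation). Let $V_1,\dots,V_p$ be smooth vector fields on $\mathcal W$ with $[V_i,V_j]=0$ for $i\ne j$ and $\|V_m(w)\|\le 1$ for all $m$ and $w$. For a vector field $X$, let $\exp(X)(w)$ denote the value at time $1$ of the integral curve of $X$ that starts at $w$. Let $\tau_0^m,\tau_k^m:\mathcal W\to\mathbb R$ ($m=1,\dots,p$) be differentiable functions (the baseline and the shifted covariates), put $\Delta\tau^m=\tau_k^m-\tau_0^m$, and suppose that $L_m=\sup_{w\in\mathcal W}\|\nabla\Delta\tau^m(w)\|$ is finite. Let $g_1,\dots,g_p:\mathbb R\to\mathbb R$ be continuous, strictly monotonic, differentiable functions with $|g_m'|<1/L_m$ on $\mathbb R$ (no condition if $L_m=0$). Put $$h_m(w)=\exp\big(g_m(\Delta\tau^m(w))\,V_m\big)(w),\qquad f_k=h_p\circ\cdots\circ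 h_1\circ f_0=\Big[\bigcirc_{m=1}^p\exp\big(g_m(\Delta\tau^m)V_m\big)\Big]\circ f_0 .$$ Then: 1. Every $h_m:\mathcal W\to\mathcal W$ and the total deformation $f_k:\mathcal S\to\mathcal W$ are bijective, differentiable with differentiable inverse, and orientation-preserving: their differentials are everywhere invertible with positive Jacobian determinant. 2. If $g_m$, $\tau_0^m$ and $\tau_k^m$ are $C^1$, then $h_m$ is an orientation-preserving $C^1$-diffeomorphism; if this holds for all $m$, then $f_k$ is an orientation-preserving $C^1$-diffeomorphism. 3. The joint exponential factorizes exactly: for every $w\in\mathcal W$, with the constant flow amounts $a_m=g_m(\Delta\tau^m(w))$, one has $\exp\big(\sum_{m} a_mV_m\big)=\exp(a_pV_p)\circ\cdots\circ\exp(a_1V_1)$ as maps of $\mathcal W$. 4. If $d(\Delta\tau^i)(V_j)=0$ on $\mathcal W$ for all $i\neq j$ (no channel changes the shift of another one; for instance, if the shifts are spatially constant), then $f_k(s)=\exp\big(\sum_{m} g_m(\Delta\tau^m(w))V_m\big)(w)$ with $w=f_0(s)$, for every $s\in\mathcal S$. -/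

import Mathlib

open scoped Manifold ContDiff Topology Bundle

noncomputable section

namespace Deformation

/-- An orientation of an `n`-manifold: a choice of orientation of every tangent space which is
locally constant when read in the standard local trivializations of the tangent bundle. -/
structure ManifoldOrientation (n : ℕ) (M : Type*) [TopologicalSpace M]
    [ChartedSpace (EuclideanSpace ℝ (Fin n)) M] [IsManifold (𝓡 n) ∞ M] where
  /-- the orientation of the tangent space at `x` -/
  orient : ∀ x : M, Orientation ℝ (TangentSpace (𝓡 n) x) (Fin n)
  /-- near every point the orientation is constant in the local trivialization -/
  locally_constant : ∀ x₀ : M, ∃ o : Orientation ℝ (EuclideanSpace ℝ (Fin n)) (Fin n),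
    ∀ᶠ x in 𝓝 x₀,
      ∀ hx : x ∈ (trivializationAt (EuclideanSpace ℝ (Fin n))
          (TangentSpace (𝓡 n) : M → Type _) x₀).baseSet,
        Orientation.map (Fin n)
          ((trivializationAt (EuclideanSpace ℝ (Fin n))
            (TangentSpace (𝓡 n) : M → Type _) x₀).continuousLinearEquivAt ℝ x hx).toLinearEquiv
          (orient x) = o

section Maps

variable {n : ℕ}
  {M : Type*} [TopologicalSpace M] [ChartedSpace (EuclideanSpace ℝ (Fin n)) M]
  [IsManifold (𝓡 n) ∞ M]
  {N : Type*} [TopologicalSpace N] [ChartedSpace (EuclideanSpace ℝ (Fin n)) N]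
  [IsManifold (𝓡 n) ∞ N]

/-- The derivative of `f` is at every point an isomorphism of tangent spaces which carries the
orientation of `M` to that of `N`; that is, the Jacobian determinant of `f` in positively oriented
bases is everywhere positive. -/
def PreservesOrientation (oM : ManifoldOrientation n M) (oN : ManifoldOrientation n N)
    (f : M → N) : Prop :=
  ∀ x : M, ∃ e : TangentSpace (𝓡 n) x ≃L[ℝ] TangentSpace (𝓡 n) (f x),
    (e : TangentSpace (𝓡 n) x →L[ℝ] TangentSpace (𝓡 n) (f x)) = mfderiv (𝓡 n) (𝓡 n) f x ∧
    Orientation.map (Fin n) e.toLinearEquiv (oM.orient x) = oN.orient (f x)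

/-- `f` is an orientation-preserving homeomorphism from `M` onto `N` which is differentiable and
has a differentiable inverse. -/
def IsOrientedDifferentiableIso (oM : ManifoldOrientation n M) (oN : ManifoldOrientation n N)
    (f : M → N) : Prop :=
  (∃ Φ : M ≃ₜ N, ⇑Φ = f ∧ MDifferentiable (𝓡 n) (𝓡 n) Φ ∧ MDifferentiable (𝓡 n) (𝓡 n) Φ.symm) ∧
    PreservesOrientation oM oN f

/-- `f` is an orientation-preserving `C¹` diffeomorphism from `M` onto `N`. -/
def IsOrientedDiffeo (oM : ManifoldOrientation n M) (oN : ManifoldOrientation n N)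
    (f : M → N) : Prop :=
  (∃ Φ : M ≃ₘ^1⟮𝓡 n, 𝓡 n⟯ N, ⇑Φ = f) ∧ PreservesOrientation oM oN f

end Maps

section Flows

variable {n : ℕ} {W : Type*} [TopologicalSpace W] [ChartedSpace (EuclideanSpace ℝ (Fin n)) W]
  [IsManifold (𝓡 n) ∞ W]

open Classical in
/-- The exponential of a vector field `X`: the point `w` is sent to the time-one value of the
integral curve of `X` that starts at `w`. (For a smooth field on a compact manifold without
boundary this curve exists and is unique; points without a global integral curve, which do not
occur there, are left fixed.) -/
def vexp (X : ∀ w : W, TangentSpace (𝓡 n) w) (w : W) : W :=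
  if h : ∃ γ : ℝ → W, γ 0 = w ∧ IsMIntegralCurve (I := 𝓡 n) γ X then h.choose 1 else w

/-- The composition `h_p ∘ ⋯ ∘ h_1`, the map with the smallest index being applied first. -/
def seqComp {p : ℕ} (h : Fin p → W → W) : W → W :=
  fun w => Fin.foldl p (fun x m => h m x) w

/-- The relative deformation of one channel, `w ↦ exp(g(δ(w)) V)(w)`, where `V` is the velocity
field, `g` the link function and `δ` the covariate shift. -/
def channelDeformation (V : ∀ w : W, TangentSpace (𝓡 n) w) (g : ℝ → ℝ) (δ : W → ℝ) : W → W :=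
  fun w => vexp (g (δ w) • V) w

/-- The total deformation `h_p ∘ ⋯ ∘ h_1 ∘ f₀` with `h_m = exp(g_m(δ_m) V_m)`. -/
def totalDeformation {S : Type*} {p : ℕ} (V : Fin p → ∀ w : W, TangentSpace (𝓡 n) w)
    (g : Fin p → ℝ → ℝ) (δ : Fin p → W → ℝ) (f₀ : S → W) : S → W :=
  seqComp (fun m => channelDeformation (V m) (g m) (δ m)) ∘ f₀

/-- The gradient of a real function for the Riemannian metric: the vector that represents the
differential. -/
def grad [Bundle.RiemannianBundle (fun w : W => TangentSpace (𝓡 n) w)]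
    (δ : W → ℝ) (w : W) : TangentSpace (𝓡 n) w :=
  haveI : FiniteDimensional ℝ (TangentSpace (𝓡 n) w) :=
    inferInstanceAs (FiniteDimensional ℝ (EuclideanSpace ℝ (Fin n)))
  haveI : CompleteSpace (TangentSpace (𝓡 n) w) := FiniteDimensional.complete ℝ _
  (InnerProductSpace.toDual ℝ (TangentSpace (𝓡 n) w)).symm (mfderiv (𝓡 n) 𝓘(ℝ, ℝ) δ w)

end Flows

end Deformation

end

/-! Let `Φ_t` be the flow of a channel field `V` and let `u = g ∘ δ`, where `δ` is the covariate
shift. The channel map is the flow with variable time, `h(w) = Φ_{u(w)}(w)`. Since `Φ_t` carries `V`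
to itself, the chain rule gives `dh = dΦ_{u(w)} ∘ (id + du ⊗ V)`. The second factor has determinant
`1 + du(V)`, and `|du(V)| ≤ |g'| ‖grad δ‖ ‖V‖ < 1`, so it is positive. The first factor preserves
the orientation because the flow is joined to the identity. Hence `dh` is invertible and
orientation-preserving (`preservesOrientationAt_flow_time`).

Bijectivity is a question on each flow line, because `h(Φ_t w) = Φ_{t + u(Φ_t w)} w`. The function
`t + u(Φ_t w)` has derivative `1 + du(V) > 0`, and `u` is bounded by compactness, so it is strictly
increasing and takes the value `0` (`bijective_flow_time`). A continuous bijection of compact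
Hausdorff spaces is a homeomorphism, and its inverse is differentiable wherever the derivative is
invertible, even if `u` is not `C¹`. All these properties pass to compositions.

For the joint exponential, a vanishing bracket means that each flow carries the other fields to
themselves (`mfderiv_flow_apply`). The composed flows at times `t a_m` are therefore an integral
curve of `∑ a_m V_m`. If each shift is constant along the flow lines of the other channels, all flow
amounts can be read off at the initial point.

All of this needs a global flow that is jointly `C¹`. It is built from Picard–Lindelöf for the field
coupled with its variational equation, from Grönwall estimates, and from compactness with the group
law. -/

namespace Deformation

/-! ### Grönwall's inequality and local flows in a normed space -/

section LocalFlow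

open Set Metric Function

variable {E : Type*} [NormedAddCommGroup E] [NormedSpace ℝ E]

/-- Grönwall's inequality on a symmetric interval around the initial time. -/
theorem norm_le_gronwallBound_abs {u u' : ℝ → E} {a K δ : ℝ}
    (hu : ∀ t ∈ Ioo (-a) a, HasDerivAt u (u' t) t)
    (hb : ∀ t ∈ Ioo (-a) a, ‖u' t‖ ≤ K * ‖u t‖ + δ) {t : ℝ} (ht : t ∈ Ioo (-a) a) :
    ‖u t‖ ≤ gronwallBound ‖u 0‖ K δ |t| := by
  rcases le_total 0 t with h | h
  · have hsub : Icc 0 t ⊆ Ioo (-a) a := fun s hs => ⟨by linarith [hs.1, ht.2], hs.2.trans_lt ht.2⟩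
    have := norm_le_gronwallBound_of_norm_deriv_right_le (f := u) (f' := u') (δ := ‖u 0‖) (K := K)
      (ε := δ) (a := 0) (b := t)
      (fun s hs => (hu s (hsub hs)).continuousAt.continuousWithinAt)
      (fun s hs => (hu s (hsub (Ico_subset_Icc_self hs))).hasDerivWithinAt) le_rfl
      (fun s hs => hb s (hsub (Ico_subset_Icc_self hs))) t ⟨h, le_rfl⟩
    simpa [abs_of_nonneg h] using this
  · have hsub : ∀ s ∈ Icc 0 (-t), -s ∈ Ioo (-a) a :=
      fun s hs => ⟨by linarith [hs.2, ht.1], by linarith [hs.1, ht.1]⟩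
    have hd : ∀ s ∈ Icc 0 (-t), HasDerivAt (fun s => u (-s)) (-(u' (-s))) s := fun s hs => by
      simpa [comp_def] using (hu (-s) (hsub s hs)).scomp s (hasDerivAt_neg s)
    have := norm_le_gronwallBound_of_norm_deriv_right_le (f := fun s => u (-s))
      (f' := fun s => -(u' (-s))) (δ := ‖u 0‖) (K := K)
      (ε := δ) (a := 0) (b := -t)
      (fun s hs => (hd s hs).continuousAt.continuousWithinAt)
      (fun s hs => (hd s (Ico_subset_Icc_self hs)).hasDerivWithinAt) (by simp)
      (fun s hs => by simpa using hb _ (hsub s (Ico_subset_Icc_self hs))) (-t)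
      ⟨by linarith, le_rfl⟩
    simpa [abs_of_nonpos h] using this

/-- A local flow `φ` of the vector field `f` near `x₀`, together with its space derivative `A`, on
the times `(-ε, ε)` and the initial points in the ball of radius `r` around `x₀`;
the trajectories stay in `s`. -/
structure IsLocalFlow (f : E → E) (x₀ : E) (s : Set E) (ε r : ℝ)
    (φ : ℝ → E → E) (A : ℝ → E → E →L[ℝ] E) : Prop where
  time_pos : 0 < ε
  radius_pos : 0 < r
  zero_apply : ∀ x ∈ ball x₀ r, φ 0 x = x
  deriv_zero : ∀ x ∈ ball x₀ r, A 0 x = .id ℝ E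
  mem : ∀ t ∈ Ioo (-ε) ε, ∀ x ∈ ball x₀ r, φ t x ∈ s
  hasDerivAt : ∀ t ∈ Ioo (-ε) ε, ∀ x ∈ ball x₀ r, HasDerivAt (φ · x) (f (φ t x)) t
  hasDerivAt_deriv : ∀ t ∈ Ioo (-ε) ε, ∀ x ∈ ball x₀ r,
    HasDerivAt (A · x) ((fderiv ℝ f (φ t x)).comp (A t x)) t
  continuousAt : ∀ t ∈ Ioo (-ε) ε, ∀ x ∈ ball x₀ r, ContinuousAt ↿φ (t, x)
  continuousAt_deriv : ∀ t ∈ Ioo (-ε) ε, ∀ x ∈ ball x₀ r, ContinuousAt ↿A (t, x)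

/-- The derivative of a `C²` vector field, coupled with the field, is a `C¹` vector field, whose
local flow consists of the flow and a candidate for its derivative. -/
theorem exists_isLocalFlow [CompleteSpace E] {f : E → E} {x₀ : E} (hf : ContDiffAt ℝ 2 f x₀)
    {s : Set E} (hs : s ∈ 𝓝 x₀) :
    ∃ ε r φ A, IsLocalFlow f x₀ s ε r φ A := by
  let F : E × (E →L[ℝ] E) → E × (E →L[ℝ] E) := fun p => (f p.1, (fderiv ℝ f p.1).comp p.2)
  let p₀ : E × (E →L[ℝ] E) := (x₀, .id ℝ E)
  have hF : ContDiffAt ℝ 1 F p₀ := by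
    have h1 : ContDiffAt ℝ 1 (fun p : E × (E →L[ℝ] E) => f p.1) p₀ :=
      (hf.of_le (by norm_num)).comp p₀ contDiffAt_fst
    have h2 : ContDiffAt ℝ 1 (fun p : E × (E →L[ℝ] E) => fderiv ℝ f p.1) p₀ :=
      ContDiffAt.comp p₀ (hf.fderiv_right (by norm_num)) contDiffAt_fst
    exact h1.prodMk (h2.clm_comp contDiffAt_snd)
  obtain ⟨ε, hε, a, r, L, K, hr, hpl⟩ := IsPicardLindelof.of_contDiffAt_one hF
  obtain ⟨α, hα, hαc⟩ :=
    (hpl 0).exists_forall_mem_closedBall_eq_hasDerivWithinAt_continuousOn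
  simp only [zero_sub, zero_add] at hα hαc
  have hαc' : ∀ p ∈ ball p₀ r, ∀ t ∈ Ioo (-ε) ε, ContinuousAt α (p, t) := fun p hp t ht =>
    hαc.continuousAt (prod_mem_nhds (Filter.mem_of_superset (isOpen_ball.mem_nhds hp)
      ball_subset_closedBall) (Icc_mem_nhds ht.1 ht.2))
  have hιc : Continuous fun q : ℝ × E => ((q.2, ContinuousLinearMap.id ℝ E), q.1) := by fun_prop
  have h0 : α (p₀, 0) = p₀ := (hα p₀ (mem_closedBall_self r.2)).1
  -- Joint continuity at `(0, x₀)` keeps the trajectories in `s` once time and radius are also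
  -- bounded by the `δ` obtained from this.
  have hev : ∀ᶠ q : ℝ × E in 𝓝 (0, x₀), (α ((q.2, .id ℝ E), q.1)).1 ∈ s := by
    have : ContinuousAt (fun q : ℝ × E => (α ((q.2, .id ℝ E), q.1)).1) (0, x₀) :=
      continuousAt_fst.comp (ContinuousAt.comp (f := fun q : ℝ × E =>
        ((q.2, ContinuousLinearMap.id ℝ E), q.1)) (x := (0, x₀))
        (hαc' p₀ (mem_ball_self hr) 0 ⟨by linarith, hε⟩) hιc.continuousAt)
    exact this (by simpa [p₀] using (show s ∈ 𝓝 (α (p₀, 0)).1 by rw [h0]; exact hs))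
  obtain ⟨δ, hδ, hball⟩ := Metric.eventually_nhds_iff_ball.1 hev
  have hsub : ∀ x ∈ ball x₀ (min δ r), ((x, .id ℝ E) : E × (E →L[ℝ] E)) ∈ ball p₀ r := by
    intro x hx
    rw [mem_ball, Prod.dist_eq]
    simpa [p₀, hr] using (lt_min_iff.1 (mem_ball.1 hx)).2
  have hder : ∀ t ∈ Ioo (-(min ε δ)) (min ε δ), ∀ x ∈ ball x₀ (min δ r),
      HasDerivAt (fun t => α ((x, .id ℝ E), t)) (F (α ((x, .id ℝ E), t))) t := fun t ht x hx => by
    have ht' : t ∈ Ioo (-ε) ε :=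
      ⟨by linarith [ht.1, min_le_left ε δ], ht.2.trans_le (min_le_left _ _)⟩
    exact ((hα _ (ball_subset_closedBall (hsub x hx))).2 t (Ioo_subset_Icc_self ht')).hasDerivAt
      (Icc_mem_nhds ht'.1 ht'.2)
  have hcont : ∀ t ∈ Ioo (-(min ε δ)) (min ε δ), ∀ x ∈ ball x₀ (min δ r),
      ContinuousAt (fun q : ℝ × E => α ((q.2, .id ℝ E), q.1)) (t, x) := fun t ht x hx => by
    have ht' : t ∈ Ioo (-ε) ε :=
      ⟨by linarith [ht.1, min_le_left ε δ], ht.2.trans_le (min_le_left _ _)⟩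
    exact ContinuousAt.comp (f := fun q : ℝ × E =>
        ((q.2, ContinuousLinearMap.id ℝ E), q.1)) (x := (t, x))
        (hαc' _ (hsub x hx) t ht') hιc.continuousAt
  refine ⟨min ε δ, min δ r, fun t x => (α ((x, .id ℝ E), t)).1, fun t x => (α ((x, .id ℝ E), t)).2,
    lt_min hε hδ, lt_min hδ hr, fun x hx => ?_, fun x hx => ?_, fun t ht x hx => ?_,
    fun t ht x hx => ?_, fun t ht x hx => ?_, fun t ht x hx => ?_, fun t ht x hx => ?_⟩
  · simp only [(hα _ (ball_subset_closedBall (hsub x hx))).1]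
  · simp only [(hα _ (ball_subset_closedBall (hsub x hx))).1]
  · refine hball (t, x) ?_
    rw [mem_ball, Prod.dist_eq, max_lt_iff]
    refine ⟨?_, (lt_min_iff.1 (mem_ball.1 hx)).1⟩
    simpa [Real.dist_eq] using (abs_lt.2 ht).trans_le (min_le_right _ _)
  · exact (hasFDerivAt_fst.comp_hasDerivAt t (hder t ht x hx))
  · exact (hasFDerivAt_snd.comp_hasDerivAt t (hder t ht x hx))
  · exact continuousAt_fst.comp (hcont t ht x hx)
  · exact continuousAt_snd.comp (hcont t ht x hx)

end LocalFlow

/-! ### `C¹` dependence on the initial point, and fields invariant under the flow -/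

section LocalFlow

open Set Metric Function Asymptotics

variable {E : Type*} [NormedAddCommGroup E] [NormedSpace ℝ E]
  {f : E → E} {x₀ : E} {s : Set E} {ε r : ℝ} {φ : ℝ → E → E} {A : ℝ → E → E →L[ℝ] E}

theorem gronwallBound_zero_eq_mul (K δ t : ℝ) :
    gronwallBound 0 K δ t = δ * gronwallBound 0 K 1 t := by
  unfold gronwallBound
  split_ifs <;> ring

/-- The linearization error of a map with Lipschitz derivative is quadratic. -/
theorem norm_sub_sub_fderiv_le (hs : Convex ℝ s) (hd : ∀ x ∈ s, DifferentiableAt ℝ f x) {M : ℝ}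
    (hM : ∀ x ∈ s, ∀ y ∈ s, ‖fderiv ℝ f x - fderiv ℝ f y‖ ≤ M * ‖x - y‖) (hM0 : 0 ≤ M)
    {a b : E} (ha : a ∈ s) (hb : b ∈ s) :
    ‖f b - f a - fderiv ℝ f a (b - a)‖ ≤ M * ‖b - a‖ ^ 2 := by
  have hseg : segment ℝ a b ⊆ s := hs.segment_subset ha hb
  -- On the segment the derivative differs from that at `a` by at most `M * ‖b - a‖`; the mean value
  -- inequality contributes the second factor.
  have := (convex_segment (𝕜 := ℝ) a b).norm_image_sub_le_of_norm_fderiv_le'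
    (f := f) (φ := fderiv ℝ f a) (C := M * ‖b - a‖) (fun w hw => hd w (hseg hw))
    (fun w hw => (hM w (hseg hw) a ha).trans ?_) (left_mem_segment ℝ a b) (right_mem_segment ℝ a b)
  · rwa [mul_assoc, ← sq] at this
  · gcongr
    obtain ⟨c, hc, rfl⟩ := (segment_eq_image' ℝ a b ▸ hw : w ∈ (fun θ : ℝ => a + θ • (b - a)) '' _)
    simp only [add_sub_cancel_left, norm_smul, Real.norm_of_nonneg hc.1]
    exact mul_le_of_le_one_left (norm_nonneg _) hc.2

/-- The flow depends differentiably on the initial point. -/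
theorem IsLocalFlow.hasFDerivAt (h : IsLocalFlow f x₀ s ε r φ A) (hs : Convex ℝ s)
    (hd : ∀ x ∈ s, DifferentiableAt ℝ f x) {K M : ℝ} (hK : ∀ x ∈ s, ‖fderiv ℝ f x‖ ≤ K)
    (hM : ∀ x ∈ s, ∀ y ∈ s, ‖fderiv ℝ f x - fderiv ℝ f y‖ ≤ M * ‖x - y‖) (hM0 : 0 ≤ M)
    {t : ℝ} (ht : t ∈ Ioo (-ε) ε) {x : E} (hx : x ∈ ball x₀ r) :
    HasFDerivAt (φ t) (A t x) x := by
  have hε := h.time_pos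
  have h0 : (0 : ℝ) ∈ Ioo (-ε) ε := ⟨by linarith, hε⟩
  have hK0 : 0 ≤ K := (norm_nonneg _).trans (hK _ (h.mem 0 h0 x hx))
  -- Grönwall for the difference of two trajectories; bounding `|τ|` by `ε` makes the constant
  -- uniform in time.
  have lip : ∀ z ∈ ball x₀ r, ∀ τ ∈ Ioo (-ε) ε,
      ‖φ τ z - φ τ x‖ ≤ Real.exp (K * ε) * ‖z - x‖ := by
    intro z hz τ hτ
    have := norm_le_gronwallBound_abs (u := fun τ => φ τ z - φ τ x) (K := K) (δ := 0)
      (fun τ hτ => (h.hasDerivAt τ hτ z hz).sub (h.hasDerivAt τ hτ x hx))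
      (fun τ hτ => by
        rw [add_zero]
        exact hs.norm_image_sub_le_of_norm_fderiv_le hd hK (h.mem τ hτ x hx) (h.mem τ hτ z hz)) hτ
    rw [gronwallBound_ε0, h.zero_apply z hz, h.zero_apply x hx, mul_comm] at this
    refine this.trans ?_
    gcongr
    exact (abs_lt.2 hτ).le
  -- The error vanishes at time `0` and solves the linearized equation up to the remainder of `f`,
  -- which is quadratic in `‖z - x‖` by `lip`; Grönwall keeps it quadratic.
  have key : ∀ z ∈ ball x₀ r, ‖φ t z - φ t x - A t x (z - x)‖ ≤
      (M * Real.exp (K * ε) ^ 2 * gronwallBound 0 K 1 |t|) * ‖‖z - x‖ ^ 2‖ := by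
    intro z hz
    have := norm_le_gronwallBound_abs (u := fun τ => φ τ z - φ τ x - A τ x (z - x)) (K := K)
      (u' := fun τ => f (φ τ z) - f (φ τ x) - (fderiv ℝ f (φ τ x)).comp (A τ x) (z - x))
      (δ := M * (Real.exp (K * ε) * ‖z - x‖) ^ 2)
      (fun τ hτ => ((h.hasDerivAt τ hτ z hz).sub (h.hasDerivAt τ hτ x hx)).sub
        ((h.hasDerivAt_deriv τ hτ x hx).clm_apply (hasDerivAt_const τ (z - x)) |>.congr_deriv
          (by simp)))
      (fun τ hτ => by
        have e : f (φ τ z) - f (φ τ x) - (fderiv ℝ f (φ τ x)).comp (A τ x) (z - x) =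
            fderiv ℝ f (φ τ x) (φ τ z - φ τ x - A τ x (z - x)) +
            (f (φ τ z) - f (φ τ x) - fderiv ℝ f (φ τ x) (φ τ z - φ τ x)) := by
          simp only [ContinuousLinearMap.comp_apply, map_sub]; abel
        rw [e]
        refine (norm_add_le _ _).trans (add_le_add ?_ ?_)
        · exact ContinuousLinearMap.le_of_opNorm_le _ (hK _ (h.mem τ hτ x hx)) _
        · refine (norm_sub_sub_fderiv_le hs hd hM hM0 (h.mem τ hτ x hx) (h.mem τ hτ z hz)).trans ?_
          gcongr
          exact lip z hz τ hτ) ht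
    rw [h.zero_apply z hz, h.zero_apply x hx, h.deriv_zero x hx] at this
    simp only [ContinuousLinearMap.id_apply, sub_self, norm_zero] at this
    rw [gronwallBound_zero_eq_mul] at this
    refine this.trans_eq ?_
    rw [norm_pow, norm_norm]
    ring
  rw [hasFDerivAt_iff_isLittleO]
  have hO : (fun z => φ t z - φ t x - A t x (z - x)) =O[𝓝 x] fun z => ‖z - x‖ ^ 2 :=
    IsBigO.of_bound _ (Filter.eventually_of_mem (isOpen_ball.mem_nhds hx) key)
  refine hO.trans_isLittleO ?_
  have ht0 : Filter.Tendsto (fun z => z - x) (𝓝 x) (𝓝 0) :=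
    tendsto_sub_nhds_zero_iff.2 Filter.tendsto_id
  exact (isLittleO_norm_pow_id one_lt_two).comp_tendsto ht0

/-- The flow is jointly continuously differentiable in time and initial point. -/
theorem IsLocalFlow.contDiffAt (h : IsLocalFlow f x₀ s ε r φ A) (hfc : ∀ x ∈ s, ContinuousAt f x)
    (hA : ∀ t ∈ Ioo (-ε) ε, ∀ x ∈ ball x₀ r, HasFDerivAt (φ t) (A t x) x)
    {t : ℝ} (ht : t ∈ Ioo (-ε) ε) {x : E} (hx : x ∈ ball x₀ r) :
    ContDiffAt ℝ 1 ↿φ (t, x) := by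
  have hU : ∀ q ∈ Ioo (-ε) ε ×ˢ ball x₀ r, Ioo (-ε) ε ×ˢ ball x₀ r ∈ 𝓝 q := fun q hq =>
    (isOpen_Ioo.prod isOpen_ball).mem_nhds hq
  let B : ℝ → E → ℝ →L[ℝ] E := fun t x => ContinuousLinearMap.toSpanSingleton ℝ (f (φ t x))
  have hB : ∀ q ∈ Ioo (-ε) ε ×ˢ ball x₀ r, ContinuousAt ↿B q := fun q hq => by
    have h1 : ContinuousAt (fun q : ℝ × E => f (φ q.1 q.2)) q :=
      ContinuousAt.comp (f := ↿φ) (hfc _ (h.mem q.1 hq.1 q.2 hq.2))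
        (h.continuousAt q.1 hq.1 q.2 hq.2)
    exact ((ContinuousLinearMap.toSpanSingletonCLE (𝕜 := ℝ) (E := E)).continuous.continuousAt.comp
      h1)
  have hA' : ∀ q ∈ Ioo (-ε) ε ×ˢ ball x₀ r, ContinuousAt ↿A q := fun q hq =>
    h.continuousAt_deriv q.1 hq.1 q.2 hq.2
  rw [contDiffAt_one_iff]
  refine ⟨fun q => (↿B q).coprod (↿A q), _, hU (t, x) ⟨ht, hx⟩, fun q hq => ?_, fun q hq => ?_⟩
  · exact ((ContinuousLinearMap.coprodEquivL (S := ℝ) ..).continuous.continuousAt.comp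
      ((hB q hq).prodMk (hA' q hq))).continuousWithinAt
  · exact (hasStrictFDerivAt_uncurry_coprod
      (Filter.eventually_of_mem (hU q hq) fun v hv => (h.hasDerivAt v.1 hv.1 v.2 hv.2).hasFDerivAt)
      (Filter.eventually_of_mem (hU q hq) fun v hv => hA v.1 hv.1 v.2 hv.2)
      (hB q hq) (hA' q hq)).hasFDerivAt

/-- If the Lie bracket of `f` and `g` vanishes, then the flow of `f` carries `g` to itself. -/
theorem IsLocalFlow.deriv_apply_eq (h : IsLocalFlow f x₀ s ε r φ A) {K : ℝ}
    (hK : ∀ x ∈ s, ‖fderiv ℝ f x‖ ≤ K) {g : E → E} (hg : ∀ x ∈ s, DifferentiableAt ℝ g x)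
    (hfg : ∀ x ∈ s, fderiv ℝ g x (f x) = fderiv ℝ f x (g x))
    {t : ℝ} (ht : t ∈ Ioo (-ε) ε) {x : E} (hx : x ∈ ball x₀ r) :
    A t x (g x) = g (φ t x) := by
  -- By `hfg` this difference solves the homogeneous linearized equation, and it starts at `0`, so
  -- Grönwall forces it to vanish.
  have := norm_le_gronwallBound_abs (u := fun τ => A τ x (g x) - g (φ τ x)) (K := K) (δ := 0)
    (u' := fun τ => (fderiv ℝ f (φ τ x)).comp (A τ x) (g x) - fderiv ℝ g (φ τ x) (f (φ τ x)))
    (fun τ hτ => ((h.hasDerivAt_deriv τ hτ x hx).clm_apply (hasDerivAt_const τ (g x)) |>.congr_deriv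
      (by simp)).sub ((hg _ (h.mem τ hτ x hx)).hasFDerivAt.comp_hasDerivAt τ
        (h.hasDerivAt τ hτ x hx)))
    (fun τ hτ => by
      rw [hfg _ (h.mem τ hτ x hx), ContinuousLinearMap.comp_apply, ← map_sub, add_zero]
      exact ContinuousLinearMap.le_of_opNorm_le _ (hK _ (h.mem τ hτ x hx)) _) ht
  rw [h.zero_apply x hx, h.deriv_zero x hx] at this
  simpa [gronwallBound_ε0, sub_eq_zero] using this

/-- A `C²` vector field has near every point a `C¹` local flow, in a neighbourhood on which the
field is differentiable with bounded derivative. -/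
theorem exists_contDiff_isLocalFlow [CompleteSpace E] (hf : ContDiffAt ℝ 2 f x₀)
    (hs : s ∈ 𝓝 x₀) :
    ∃ ε r φ A, IsLocalFlow f x₀ s ε r φ A ∧
      (∀ t ∈ Ioo (-ε) ε, ∀ x ∈ ball x₀ r, HasFDerivAt (φ t) (A t x) x) ∧
      (∀ t ∈ Ioo (-ε) ε, ∀ x ∈ ball x₀ r, ContDiffAt ℝ 1 ↿φ (t, x)) ∧
      ∀ g : E → E, (∀ x ∈ s, DifferentiableAt ℝ g x) →
        (∀ x ∈ s, fderiv ℝ g x (f x) = fderiv ℝ f x (g x)) →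
        ∀ t ∈ Ioo (-ε) ε, ∀ x ∈ ball x₀ r, A t x (g x) = g (φ t x) := by
  have hf' : ContDiffAt ℝ 1 (fderiv ℝ f) x₀ := hf.fderiv_right (by norm_num)
  obtain ⟨M, u, hu, hM⟩ := hf'.exists_lipschitzOnWith
  have hK : ∀ᶠ x in 𝓝 x₀, ‖fderiv ℝ f x‖ ≤ ‖fderiv ℝ f x₀‖ + 1 :=
    (hf'.continuousAt.norm.eventually_lt continuousAt_const (by simp)).mono fun x hx => le_of_lt hx
  have hd : ∀ᶠ x in 𝓝 x₀, DifferentiableAt ℝ f x :=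
    (hf.eventually (by simp)).mono fun x hx => hx.differentiableAt (by norm_num)
  obtain ⟨ρ, hρ, hball⟩ := Metric.eventually_nhds_iff_ball.1 ((hK.and hd).and
    (Filter.Eventually.and hu hs : ∀ᶠ x in 𝓝 x₀, x ∈ u ∧ x ∈ s))
  -- The trajectories are confined to a ball rather than to `s` because the mean value estimates
  -- need convexity.
  obtain ⟨ε, r, φ, A, h⟩ := exists_isLocalFlow hf (ball_mem_nhds x₀ hρ)
  have hA : ∀ t ∈ Ioo (-ε) ε, ∀ x ∈ ball x₀ r, HasFDerivAt (φ t) (A t x) x := fun t ht x hx =>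
    h.hasFDerivAt (convex_ball x₀ ρ) (fun x hx => (hball x hx).1.2) (fun x hx => (hball x hx).1.1)
      (fun x hx y hy => by
        simpa [dist_eq_norm] using hM.dist_le_mul x (hball x hx).2.1 y (hball y hy).2.1)
      M.2 ht hx
  refine ⟨ε, r, φ, A, ⟨h.1, h.2, h.3, h.4, fun t ht x hx => (hball _ (h.mem t ht x hx)).2.2,
    h.6, h.7, h.8, h.9⟩, hA, fun t ht x hx => ?_, fun g hg hfg t ht x hx => ?_⟩
  · exact h.contDiffAt (fun x hx => (hball x hx).1.2.continuousAt) hA ht hx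
  · exact h.deriv_apply_eq (fun x hx => (hball x hx).1.1) (fun x hx => hg x (hball x hx).2.2)
      (fun x hx => hfg x (hball x hx).2.2) ht hx

end LocalFlow

/-! ### Maps that preserve orientation at a point -/

section Orientations

variable {n : ℕ}

theorem orientation_map_trans {F G H : Type*} [AddCommGroup F] [Module ℝ F]
    [AddCommGroup G] [Module ℝ G] [AddCommGroup H] [Module ℝ H] (e : F ≃ₗ[ℝ] G) (e' : G ≃ₗ[ℝ] H)
    (o : Orientation ℝ F (Fin n)) :
    Orientation.map (Fin n) (e.trans e') o =
      Orientation.map (Fin n) e' (Orientation.map (Fin n) e o) := by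
  induction o using Module.Ray.ind with
  | h v hv => rfl

theorem orientation_map_symm_eq {F G : Type*} [AddCommGroup F] [Module ℝ F]
    [AddCommGroup G] [Module ℝ G] {e : F ≃ₗ[ℝ] G}
    {o : Orientation ℝ F (Fin n)} {o' : Orientation ℝ G (Fin n)}
    (h : Orientation.map (Fin n) e o = o') : Orientation.map (Fin n) e.symm o' = o := by
  rw [← h, ← Orientation.map_symm, Equiv.symm_apply_apply]

variable {M : Type*} [TopologicalSpace M] [ChartedSpace (EuclideanSpace ℝ (Fin n)) M]
  [IsManifold (𝓡 n) ∞ M]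
  {N : Type*} [TopologicalSpace N] [ChartedSpace (EuclideanSpace ℝ (Fin n)) N]
  [IsManifold (𝓡 n) ∞ N]
  {P : Type*} [TopologicalSpace P] [ChartedSpace (EuclideanSpace ℝ (Fin n)) P]
  [IsManifold (𝓡 n) ∞ P]

/-- The derivative of `f` at `x` is an isomorphism that carries the orientation at `x` to that
at `f x`. -/
def PreservesOrientationAt (oM : ManifoldOrientation n M) (oN : ManifoldOrientation n N)
    (f : M → N) (x : M) : Prop :=
  ∃ e : TangentSpace (𝓡 n) x ≃L[ℝ] TangentSpace (𝓡 n) (f x),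
    (e : TangentSpace (𝓡 n) x →L[ℝ] TangentSpace (𝓡 n) (f x)) = mfderiv (𝓡 n) (𝓡 n) f x ∧
    Orientation.map (Fin n) e.toLinearEquiv (oM.orient x) = oN.orient (f x)

variable {oM : ManifoldOrientation n M} {oN : ManifoldOrientation n N}
  {oP : ManifoldOrientation n P}

theorem PreservesOrientationAt.comp {g : N → P} {f : M → N} {x : M}
    (hg : PreservesOrientationAt oN oP g (f x)) (hf : PreservesOrientationAt oM oN f x)
    (dg : MDifferentiableAt (𝓡 n) (𝓡 n) g (f x)) (df : MDifferentiableAt (𝓡 n) (𝓡 n) f x) :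
    PreservesOrientationAt oM oP (g ∘ f) x := by
  obtain ⟨e, he, heo⟩ := hf
  obtain ⟨e', he', heo'⟩ := hg
  refine ⟨e.trans e', ?_, ?_⟩
  · rw [mfderiv_comp x dg df, ← he, ← he']
    rfl
  · refine Eq.trans ?_ heo'
    rw [← heo]
    exact orientation_map_trans e.toLinearEquiv e'.toLinearEquiv _

theorem PreservesOrientationAt.congr {g f : M → N} {x : M}
    (hf : PreservesOrientationAt oM oN f x) (h : g =ᶠ[𝓝 x] f) :
    PreservesOrientationAt oM oN g x := by
  obtain ⟨e, he, heo⟩ := hf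
  have hx := h.eq_of_nhds
  unfold PreservesOrientationAt
  rw [h.mfderiv_eq, hx]
  exact ⟨e, he, heo⟩

theorem preservesOrientationAt_id (x : M) : PreservesOrientationAt oM oM id x := by
  refine ⟨.refl ℝ _, ?_, ?_⟩
  · rw [mfderiv_id]; rfl
  · have := Orientation.map_refl (R := ℝ) (M := TangentSpace (𝓡 n) x) (ι := Fin n)
    exact congrFun (congrArg DFunLike.coe this) _

end Orientations

/-! ### Vector fields read in a chart -/

section ChartField

variable {n : ℕ} {M : Type*} [TopologicalSpace M] [ChartedSpace (EuclideanSpace ℝ (Fin n)) M]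
  [IsManifold (𝓡 n) ∞ M]

open Set Metric Function VectorField

/-- The representation of a vector field in the chart around `x₀`. -/
noncomputable def chartField (x₀ : M) (V : ∀ w : M, TangentSpace (𝓡 n) w) :
    EuclideanSpace ℝ (Fin n) → EuclideanSpace ℝ (Fin n) :=
  mpullback 𝓘(ℝ, EuclideanSpace ℝ (Fin n)) (𝓡 n) (extChartAt (𝓡 n) x₀).symm V

variable {x₀ : M} {V Y : ∀ w : M, TangentSpace (𝓡 n) w} {y : EuclideanSpace ℝ (Fin n)}

theorem contMDiffAt_extChartAt_symm_of_mem (hy : y ∈ (extChartAt (𝓡 n) x₀).target) :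
    ContMDiffAt 𝓘(ℝ, EuclideanSpace ℝ (Fin n)) (𝓡 n) ∞ (extChartAt (𝓡 n) x₀).symm y :=
  (contMDiffOn_extChartAt_symm (n := ∞) x₀).contMDiffAt
    ((isOpen_extChartAt_target x₀).mem_nhds hy)

theorem isInvertible_mfderiv_extChartAt_symm (hy : y ∈ (extChartAt (𝓡 n) x₀).target) :
    (mfderiv 𝓘(ℝ, EuclideanSpace ℝ (Fin n)) (𝓡 n) (extChartAt (𝓡 n) x₀).symm y).IsInvertible := by
  have := isInvertible_mfderivWithin_extChartAt_symm (I := 𝓡 n) hy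
  rwa [ModelWithCorners.range_eq_univ, mfderivWithin_univ] at this

theorem mfderiv_extChartAt_symm_comp (w : M) (hw : w ∈ (extChartAt (𝓡 n) x₀).source) :
    (mfderiv 𝓘(ℝ, EuclideanSpace ℝ (Fin n)) (𝓡 n) (extChartAt (𝓡 n) x₀).symm (extChartAt (𝓡 n) x₀ w)).comp
      (mfderiv (𝓡 n) 𝓘(ℝ, EuclideanSpace ℝ (Fin n)) (extChartAt (𝓡 n) x₀) w) = .id ℝ _ := by
  have := mfderivWithin_extChartAt_symm_comp_mfderiv_extChartAt' (I := 𝓡 n) hw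
  rwa [ModelWithCorners.range_eq_univ, mfderivWithin_univ] at this

theorem mfderiv_extChartAt_symm_chartField (hy : y ∈ (extChartAt (𝓡 n) x₀).target) :
    mfderiv 𝓘(ℝ, EuclideanSpace ℝ (Fin n)) (𝓡 n) (extChartAt (𝓡 n) x₀).symm y (chartField x₀ V y) =
      V ((extChartAt (𝓡 n) x₀).symm y) := by
  obtain ⟨e, he⟩ := isInvertible_mfderiv_extChartAt_symm hy
  rw [chartField, mpullback_apply, ← he, ContinuousLinearMap.inverse_equiv]
  exact e.apply_symm_apply _

theorem mfderiv_extChartAt_apply (w : M) (hw : w ∈ (extChartAt (𝓡 n) x₀).source) :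
    mfderiv (𝓡 n) 𝓘(ℝ, EuclideanSpace ℝ (Fin n)) (extChartAt (𝓡 n) x₀) w (V w) =
      chartField x₀ V (extChartAt (𝓡 n) x₀ w) := by
  have hy := (extChartAt (𝓡 n) x₀).map_source hw
  obtain ⟨e, he⟩ := isInvertible_mfderiv_extChartAt_symm hy
  have h1 := mfderiv_extChartAt_symm_chartField (V := V) hy
  have h2 := DFunLike.congr_fun (mfderiv_extChartAt_symm_comp (x₀ := x₀) w hw) (V w)
  rw [← he] at h1 h2
  apply e.injective
  -- All tangent spaces are the same model space by definition, so vectors at two provably equal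
  -- base points can be compared.
  have h3 : ∀ w', w' = w → (show EuclideanSpace ℝ (Fin n) from V w') = V w := by
    rintro _ rfl; rfl
  exact (h2.trans (h3 _ ((extChartAt (𝓡 n) x₀).left_inv hw)).symm).trans h1.symm

theorem contDiffAt_chartField
    (hV : ContMDiff (𝓡 n) (𝓡 n).tangent ∞ (fun w => (⟨w, V w⟩ : TangentBundle (𝓡 n) M)))
    (hy : y ∈ (extChartAt (𝓡 n) x₀).target) : ContDiffAt ℝ ∞ (chartField x₀ V) y := by
  have := ContMDiffAt.mpullback_vectorField_preimage (m := ∞) (n := ∞)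
    (hV ((extChartAt (𝓡 n) x₀).symm y)) (contMDiffAt_extChartAt_symm_of_mem hy)
    (isInvertible_mfderiv_extChartAt_symm hy) (by simp)
  exact contMDiffAt_vectorSpace_iff_contDiffAt.1 this

/-- Pullback along the inverse chart respects Lie brackets, and in a vector space the bracket is the
difference of the two sides. -/
theorem fderiv_chartField_apply_comm
    (hV : ContMDiff (𝓡 n) (𝓡 n).tangent ∞ (fun w => (⟨w, V w⟩ : TangentBundle (𝓡 n) M)))
    (hY : ContMDiff (𝓡 n) (𝓡 n).tangent ∞ (fun w => (⟨w, Y w⟩ : TangentBundle (𝓡 n) M)))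
    (hVY : mlieBracket (𝓡 n) V Y = 0) (hy : y ∈ (extChartAt (𝓡 n) x₀).target) :
    fderiv ℝ (chartField x₀ Y) y (chartField x₀ V y) =
      fderiv ℝ (chartField x₀ V) y (chartField x₀ Y y) := by
  have : IsManifold (𝓡 n) (minSmoothness ℝ 2) M := by
    rw [minSmoothness_of_isRCLikeNormedField]; infer_instance
  have := mpullback_mlieBracket (n := 2) ((hV ((extChartAt (𝓡 n) x₀).symm y)).mdifferentiableAt
    (by simp)) ((hY ((extChartAt (𝓡 n) x₀).symm y)).mdifferentiableAt (by simp))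
    ((contMDiffAt_extChartAt_symm_of_mem hy).of_le (by norm_cast))
    (minSmoothness_of_isRCLikeNormedField).le
  rw [hVY, mpullback_zero, ← mlieBracketWithin_univ, mlieBracketWithin_eq_lieBracketWithin]
    at this
  have h0 : 0 = lieBracketWithin ℝ (chartField x₀ V) (chartField x₀ Y) univ y := this
  rw [lieBracketWithin_univ] at h0
  exact sub_eq_zero.1 h0.symm

end ChartField

/-! ### Local flows transported from a chart to the manifold -/

section LocalFlowManifold

open Set Metric Function VectorField

variable {n : ℕ} {M : Type*} [TopologicalSpace M] [ChartedSpace (EuclideanSpace ℝ (Fin n)) M]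
  {x₀ : M} {V Y : ∀ w : M, TangentSpace (𝓡 n) w} {ε r : ℝ}
  {φ : ℝ → EuclideanSpace ℝ (Fin n) → EuclideanSpace ℝ (Fin n)}
  {A : ℝ → EuclideanSpace ℝ (Fin n) → EuclideanSpace ℝ (Fin n) →L[ℝ] EuclideanSpace ℝ (Fin n)}

/-- A flow in the chart around `x₀`, transported to the manifold. -/
noncomputable def chartFlow (x₀ : M)
    (φ : ℝ → EuclideanSpace ℝ (Fin n) → EuclideanSpace ℝ (Fin n)) (t : ℝ) (w : M) : M :=
  (extChartAt (𝓡 n) x₀).symm (φ t (extChartAt (𝓡 n) x₀ w))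

/-- The points whose image in the chart around `x₀` lies in the ball of radius `r`. -/
def chartBall (n : ℕ) {M : Type*} [TopologicalSpace M]
    [ChartedSpace (EuclideanSpace ℝ (Fin n)) M] (x₀ : M) (r : ℝ) : Set M :=
  (extChartAt (𝓡 n) x₀).source ∩ extChartAt (𝓡 n) x₀ ⁻¹' ball (extChartAt (𝓡 n) x₀ x₀) r

theorem chartBall_mem_nhds (hr : 0 < r) : chartBall n x₀ r ∈ 𝓝 x₀ :=
  Filter.inter_mem (extChartAt_source_mem_nhds x₀)
    (continuousAt_extChartAt x₀ (ball_mem_nhds _ hr))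

theorem IsLocalFlow.chartFlow_zero
    (h : IsLocalFlow (chartField x₀ V) (extChartAt (𝓡 n) x₀ x₀)
      (extChartAt (𝓡 n) x₀).target ε r φ A)
    {w : M} (hw : w ∈ chartBall n x₀ r) : chartFlow x₀ φ 0 w = w := by
  rw [chartFlow, h.zero_apply _ hw.2, (extChartAt (𝓡 n) x₀).left_inv hw.1]

variable [IsManifold (𝓡 n) ∞ M]

theorem IsLocalFlow.isMIntegralCurveOn_chartFlow
    (h : IsLocalFlow (chartField x₀ V) (extChartAt (𝓡 n) x₀ x₀)
      (extChartAt (𝓡 n) x₀).target ε r φ A)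
    {w : M} (hw : w ∈ chartBall n x₀ r) :
    IsMIntegralCurveOn (I := 𝓡 n) (chartFlow x₀ φ · w) V (Ioo (-ε) ε) := by
  intro t ht
  have hy := h.mem t ht _ hw.2
  have h1 := ((contMDiffAt_extChartAt_symm_of_mem hy).mdifferentiableAt (by simp)).hasMFDerivAt
  have h2 := (h.hasDerivAt t ht _ hw.2).hasFDerivAt.hasMFDerivAt
  refine ((h1.comp t h2).congr_mfderiv ?_).hasMFDerivWithinAt
  have h3 := mfderiv_extChartAt_symm_chartField (V := V) hy
  refine ContinuousLinearMap.ext_ring ?_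
  rw [← one_smul ℝ (chartField x₀ V _)] at h3
  exact h3.trans (one_smul ℝ _).symm

theorem IsLocalFlow.contMDiffAt_chartFlow
    (h : IsLocalFlow (chartField x₀ V) (extChartAt (𝓡 n) x₀ x₀)
      (extChartAt (𝓡 n) x₀).target ε r φ A)
    (hφ : ∀ t ∈ Ioo (-ε) ε, ∀ x ∈ ball (extChartAt (𝓡 n) x₀ x₀) r, ContDiffAt ℝ 1 ↿φ (t, x))
    {t : ℝ} (ht : t ∈ Ioo (-ε) ε) {w : M} (hw : w ∈ chartBall n x₀ r) :
    ContMDiffAt (𝓘(ℝ, ℝ).prod (𝓡 n)) (𝓡 n) 1 ↿(chartFlow x₀ φ) (t, w) := by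
  have hy := h.mem t ht _ hw.2
  have h1 : ContMDiffAt 𝓘(ℝ, EuclideanSpace ℝ (Fin n)) (𝓡 n) 1 (extChartAt (𝓡 n) x₀).symm
      (φ t (extChartAt (𝓡 n) x₀ w)) :=
    (contMDiffAt_extChartAt_symm_of_mem hy).of_le (by norm_cast)
  have h2 := (hφ t ht _ hw.2).contMDiffAt
  have h3 : ContMDiffAt (𝓡 n) 𝓘(ℝ, EuclideanSpace ℝ (Fin n)) 1 (extChartAt (𝓡 n) x₀) w :=
    contMDiffAt_extChartAt' (by simpa using hw.1)
  have h4 : ContMDiffAt (𝓘(ℝ, ℝ).prod (𝓡 n)) 𝓘(ℝ, ℝ × EuclideanSpace ℝ (Fin n)) 1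
      (fun q : ℝ × M => (q.1, extChartAt (𝓡 n) x₀ q.2)) (t, w) :=
    contMDiffAt_fst.prodMk_space (ContMDiffAt.comp (t, w) h3 contMDiffAt_snd)
  exact ContMDiffAt.comp (t, w) (g := (extChartAt (𝓡 n) x₀).symm)
    (f := fun q : ℝ × M => φ q.1 (extChartAt (𝓡 n) x₀ q.2)) h1
    (ContMDiffAt.comp (t, w) (g := ↿φ) h2 h4)

theorem IsLocalFlow.hasMFDerivAt_chartFlow
    (h : IsLocalFlow (chartField x₀ V) (extChartAt (𝓡 n) x₀ x₀)
      (extChartAt (𝓡 n) x₀).target ε r φ A)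
    (hA : ∀ t ∈ Ioo (-ε) ε, ∀ x ∈ ball (extChartAt (𝓡 n) x₀ x₀) r, HasFDerivAt (φ t) (A t x) x)
    {t : ℝ} (ht : t ∈ Ioo (-ε) ε) {w : M} (hw : w ∈ chartBall n x₀ r) :
    HasMFDerivAt (𝓡 n) (𝓡 n) (chartFlow x₀ φ t) w
      ((mfderiv 𝓘(ℝ, EuclideanSpace ℝ (Fin n)) (𝓡 n) (extChartAt (𝓡 n) x₀).symm
        (φ t (extChartAt (𝓡 n) x₀ w))).comp ((A t (extChartAt (𝓡 n) x₀ w)).comp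
        (mfderiv (𝓡 n) 𝓘(ℝ, EuclideanSpace ℝ (Fin n)) (extChartAt (𝓡 n) x₀) w))) := by
  have hy := h.mem t ht _ hw.2
  have h1 := ((contMDiffAt_extChartAt_symm_of_mem hy).mdifferentiableAt (by simp)).hasMFDerivAt
  have h2 := (hA t ht _ hw.2).hasMFDerivAt
  have h3 := (mdifferentiableAt_extChartAt (I := 𝓡 n) (x := x₀) (y := w)
    (by simpa using hw.1)).hasMFDerivAt
  exact h1.comp w (h2.comp w h3)

theorem IsLocalFlow.mfderiv_chartFlow_apply
    (h : IsLocalFlow (chartField x₀ V) (extChartAt (𝓡 n) x₀ x₀)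
      (extChartAt (𝓡 n) x₀).target ε r φ A)
    (hA : ∀ t ∈ Ioo (-ε) ε, ∀ x ∈ ball (extChartAt (𝓡 n) x₀ x₀) r, HasFDerivAt (φ t) (A t x) x)
    {t : ℝ} (ht : t ∈ Ioo (-ε) ε) {w : M} (hw : w ∈ chartBall n x₀ r)
    (hY : A t (extChartAt (𝓡 n) x₀ w) (chartField x₀ Y (extChartAt (𝓡 n) x₀ w)) =
      chartField x₀ Y (φ t (extChartAt (𝓡 n) x₀ w))) :
    mfderiv (𝓡 n) (𝓡 n) (chartFlow x₀ φ t) w (Y w) = Y (chartFlow x₀ φ t w) := by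
  rw [(h.hasMFDerivAt_chartFlow hA ht hw).mfderiv]
  have h1 := mfderiv_extChartAt_apply (x₀ := x₀) (V := Y) w hw.1
  have h2 := mfderiv_extChartAt_symm_chartField (V := Y) (h.mem t ht _ hw.2)
  rw [← hY, ← h1] at h2
  exact h2

/-- In the trivialization around `x₀` the orientation is constant and the derivative of the flow is
`A`. At time `0` this is the identity, so its determinant stays positive nearby by continuity. -/
theorem IsLocalFlow.eventually_preservesOrientationAt_chartFlow
    (h : IsLocalFlow (chartField x₀ V) (extChartAt (𝓡 n) x₀ x₀)
      (extChartAt (𝓡 n) x₀).target ε r φ A)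
    (o : ManifoldOrientation n M)
    (hA : ∀ t ∈ Ioo (-ε) ε, ∀ x ∈ ball (extChartAt (𝓡 n) x₀ x₀) r, HasFDerivAt (φ t) (A t x) x)
    (hφ : ∀ t ∈ Ioo (-ε) ε, ∀ x ∈ ball (extChartAt (𝓡 n) x₀ x₀) r, ContDiffAt ℝ 1 ↿φ (t, x)) :
    ∀ᶠ q : ℝ × M in 𝓝 (0, x₀), PreservesOrientationAt o o (chartFlow x₀ φ q.1) q.2 := by
  obtain ⟨o', ho'⟩ := o.locally_constant x₀
  have hε := h.time_pos
  have h0 : (0 : ℝ) ∈ Ioo (-ε) ε := ⟨by linarith, hε⟩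
  have hx₀ : x₀ ∈ chartBall n x₀ r := mem_of_mem_nhds (chartBall_mem_nhds h.radius_pos)
  have hdet : ∀ᶠ q : ℝ × M in 𝓝 (0, x₀), 0 < (A q.1 (extChartAt (𝓡 n) x₀ q.2)).det := by
    have hc : ContinuousAt (fun q : ℝ × M => (A q.1 (extChartAt (𝓡 n) x₀ q.2)).det) (0, x₀) :=
      ContinuousLinearMap.continuous_det.continuousAt.comp
        (ContinuousAt.comp (g := ↿A) (f := fun q : ℝ × M => (q.1, extChartAt (𝓡 n) x₀ q.2))
          (x := (0, x₀)) (h.continuousAt_deriv 0 h0 _ hx₀.2)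
          (continuousAt_fst.prodMk (ContinuousAt.comp (f := Prod.snd) (x := ((0 : ℝ), x₀))
            (continuousAt_extChartAt x₀) continuousAt_snd)))
    refine hc.eventually (lt_mem_nhds ?_)
    beta_reduce
    rw [h.deriv_zero _ hx₀.2]
    simp [ContinuousLinearMap.det]
  have hsrc : ∀ᶠ q : ℝ × M in 𝓝 (0, x₀), q.1 ∈ Ioo (-ε) ε ∧ q.2 ∈ chartBall n x₀ r :=
    prod_mem_nhds (Ioo_mem_nhds h0.1 h0.2) (chartBall_mem_nhds h.radius_pos)
  have hc : Filter.Tendsto ↿(chartFlow x₀ φ) (𝓝 (0, x₀)) (𝓝 x₀) := by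
    have := (h.contMDiffAt_chartFlow hφ h0 hx₀).continuousAt
    have h2 : ↿(chartFlow x₀ φ) (0, x₀) = x₀ := h.chartFlow_zero hx₀
    rwa [ContinuousAt, h2] at this
  filter_upwards [hdet, hsrc, hc.eventually ho', continuousAt_snd.eventually ho']
    with ⟨t, w⟩ hd ⟨ht, hw⟩ hof how
  simp only at hd ht hw hof how ⊢
  have hy := h.mem t ht _ hw.2
  have hws : w ∈ (chartAt (EuclideanSpace ℝ (Fin n)) x₀).source := by simpa using hw.1
  have hfs : chartFlow x₀ φ t w ∈ (chartAt (EuclideanSpace ℝ (Fin n)) x₀).source := by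
    have := (extChartAt (𝓡 n) x₀).map_target hy
    rwa [extChartAt_source] at this
  have hof := hof hfs
  have how := how hws
  have hright : extChartAt (𝓡 n) x₀ (chartFlow x₀ φ t w) = φ t (extChartAt (𝓡 n) x₀ w) :=
    (extChartAt (𝓡 n) x₀).right_inv hy
  set B := A t (extChartAt (𝓡 n) x₀ w) with hB
  let T := trivializationAt (EuclideanSpace ℝ (Fin n)) (TangentSpace (𝓡 n) : M → Type _) x₀
  let Tw := T.continuousLinearEquivAt ℝ w hws
  let Tf := T.continuousLinearEquivAt ℝ (chartFlow x₀ φ t w) hfs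
  let Be := B.toContinuousLinearEquivOfDetNeZero hd.ne'
  refine ⟨Tw.trans (Be.trans Tf.symm), ?_, ?_⟩
  · rw [(h.hasMFDerivAt_chartFlow hA ht hw).mfderiv]
    have h1 : (Tw : TangentSpace (𝓡 n) w →L[ℝ] EuclideanSpace ℝ (Fin n)) =
        mfderiv (𝓡 n) 𝓘(ℝ, EuclideanSpace ℝ (Fin n)) (extChartAt (𝓡 n) x₀) w := by
      rw [← TangentBundle.continuousLinearMapAt_trivializationAt hws]
      exact T.coe_continuousLinearEquivAt_eq' hws
    have h2 : (Tf.symm : EuclideanSpace ℝ (Fin n) →L[ℝ] TangentSpace (𝓡 n) (chartFlow x₀ φ t w)) =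
        mfderiv 𝓘(ℝ, EuclideanSpace ℝ (Fin n)) (𝓡 n) (extChartAt (𝓡 n) x₀).symm
          (φ t (extChartAt (𝓡 n) x₀ w)) := by
      have := TangentBundle.symmL_trivializationAt (I := 𝓡 n) hfs
      rw [ModelWithCorners.range_eq_univ, mfderivWithin_univ, hright] at this
      rw [← this]
      exact T.symm_continuousLinearEquivAt_eq' hfs
    rw [← h1, ← h2]
    ext v
    rfl
  · refine (orientation_map_trans Tw.toLinearEquiv
      (Be.toLinearEquiv.trans Tf.symm.toLinearEquiv) _).trans ?_
    rw [how, orientation_map_trans]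
    have hBo : Orientation.map (Fin n) Be.toLinearEquiv o' = o' :=
      (Orientation.map_eq_iff_det_pos o' Be.toLinearEquiv (by simp)).2 hd
    rw [hBo]
    exact orientation_map_symm_eq hof

end LocalFlowManifold

/-! ### The global flow on a compact manifold -/

section GlobalFlow

open Set Metric Function VectorField

variable {n : ℕ} {M : Type*} [TopologicalSpace M] [ChartedSpace (EuclideanSpace ℝ (Fin n)) M]
  [IsManifold (𝓡 n) ∞ M]

/-- A property of the time that holds for small times and is additive holds for all times. -/
theorem forall_real_of_eventually_zero {Q : ℝ → Prop} (h : ∀ᶠ t in 𝓝 0, Q t)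
    (hadd : ∀ s t, Q s → Q t → Q (s + t)) (t : ℝ) : Q t := by
  have ht : Filter.Tendsto (fun k : ℕ => t * ((k : ℝ) + 1)⁻¹) Filter.atTop (𝓝 0) := by
    have := (tendsto_one_div_add_atTop_nhds_zero_nat (𝕜 := ℝ)).const_mul t
    simpa using this
  -- The time `t` is the sum of `k + 1` steps of the small length `t / (k + 1)`.
  obtain ⟨k, hk⟩ := (ht.eventually h).exists
  have hm : ∀ m : ℕ, Q (((m : ℝ) + 1) * (t * ((k : ℝ) + 1)⁻¹)) := by
    intro m
    induction m with
    | zero => simpa using hk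
    | succ m ih =>
      have := hadd _ _ ih hk
      rwa [← add_one_mul, ← Nat.cast_succ] at this
  have := hm k
  rwa [mul_left_comm, mul_inv_cancel₀ (by positivity), mul_one] at this

/-- The flow of a vector field: the integral curve that starts at `w`, at time `t`. -/
noncomputable def flow (V : ∀ w : M, TangentSpace (𝓡 n) w) (t : ℝ) (w : M) : M := vexp (t • V) w

variable {V Y : ∀ w : M, TangentSpace (𝓡 n) w}

/-- Uniqueness of integral curves makes the curve chosen in `vexp` immaterial. -/
theorem vexp_eq [T2Space M]
    (hV : ContMDiff (𝓡 n) (𝓡 n).tangent ∞ (fun w => (⟨w, V w⟩ : TangentBundle (𝓡 n) M)))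
    {γ : ℝ → M} (hγ : IsMIntegralCurve (I := 𝓡 n) γ V) : vexp V (γ 0) = γ 1 := by
  have h : ∃ γ' : ℝ → M, γ' 0 = γ 0 ∧ IsMIntegralCurve (I := 𝓡 n) γ' V := ⟨γ, rfl, hγ⟩
  rw [vexp, dif_pos h]
  exact congrFun (isMIntegralCurve_Ioo_eq_of_contMDiff_boundaryless (t₀ := 0)
    (hV.of_le (by norm_cast)) h.choose_spec.2 hγ h.choose_spec.1) 1

theorem flow_eq [T2Space M]
    (hV : ContMDiff (𝓡 n) (𝓡 n).tangent ∞ (fun w => (⟨w, V w⟩ : TangentBundle (𝓡 n) M)))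
    {γ : ℝ → M} (hγ : IsMIntegralCurve (I := 𝓡 n) γ V) (t : ℝ) : flow V t (γ 0) = γ t := by
  have := vexp_eq (hV.const_smul_section (a := t)) (hγ.comp_mul t)
  simpa [flow] using this

theorem exists_chartFlow
    (hV : ContMDiff (𝓡 n) (𝓡 n).tangent ∞ (fun w => (⟨w, V w⟩ : TangentBundle (𝓡 n) M)))
    (x₀ : M) :
    ∃ ε r φ A, IsLocalFlow (chartField x₀ V) (extChartAt (𝓡 n) x₀ x₀)
        (extChartAt (𝓡 n) x₀).target ε r φ A ∧
      (∀ t ∈ Ioo (-ε) ε, ∀ x ∈ ball (extChartAt (𝓡 n) x₀ x₀) r, HasFDerivAt (φ t) (A t x) x) ∧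
      (∀ t ∈ Ioo (-ε) ε, ∀ x ∈ ball (extChartAt (𝓡 n) x₀ x₀) r, ContDiffAt ℝ 1 ↿φ (t, x)) ∧
      ∀ g, (∀ x ∈ (extChartAt (𝓡 n) x₀).target, DifferentiableAt ℝ g x) →
        (∀ x ∈ (extChartAt (𝓡 n) x₀).target,
          fderiv ℝ g x (chartField x₀ V x) = fderiv ℝ (chartField x₀ V) x (g x)) →
        ∀ t ∈ Ioo (-ε) ε, ∀ x ∈ ball (extChartAt (𝓡 n) x₀ x₀) r, A t x (g x) = g (φ t x) :=
  exists_contDiff_isLocalFlow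
    ((contDiffAt_chartField hV (mem_extChartAt_target x₀)).of_le (by norm_cast))
    (extChartAt_target_mem_nhds x₀)

/-- On a compact manifold the integral curves of a smooth vector field exist for all times. -/
theorem exists_isMIntegralCurve [CompactSpace M] [T2Space M]
    (hV : ContMDiff (𝓡 n) (𝓡 n).tangent ∞ (fun w => (⟨w, V w⟩ : TangentBundle (𝓡 n) M)))
    (w : M) : ∃ γ : ℝ → M, γ 0 = w ∧ IsMIntegralCurve (I := 𝓡 n) γ V := by
  have hloc : ∀ x₀ ∈ (univ : Set M), ∀ᶠ q : ℝ × M in 𝓝 (0, x₀), ∃ γ : ℝ → M, γ 0 = q.2 ∧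
      IsMIntegralCurveOn (I := 𝓡 n) γ V (Ioo (-q.1) q.1) := by
    intro x₀ _
    obtain ⟨ε, r, φ, A, h, -⟩ := exists_chartFlow hV x₀
    filter_upwards [prod_mem_nhds (Iio_mem_nhds h.time_pos)
      (chartBall_mem_nhds (n := n) h.radius_pos)] with q hq
    exact ⟨(chartFlow x₀ φ · q.2), h.chartFlow_zero hq.2,
      (h.isMIntegralCurveOn_chartFlow hq.2).mono
        (Ioo_subset_Ioo (neg_le_neg (le_of_lt hq.1)) (le_of_lt hq.1))⟩
  -- Compactness gives one existence time for all initial points, and a uniform time suffices to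
  -- continue every curve to all of `ℝ`.
  have := isCompact_univ.eventually_forall_of_forall_eventually
    (P := fun a w => ∃ γ : ℝ → M, γ 0 = w ∧ IsMIntegralCurveOn (I := 𝓡 n) γ V (Ioo (-a) a)) hloc
  obtain ⟨a, ha, ha0⟩ := ((this.filter_mono nhdsWithin_le_nhds).and
    (self_mem_nhdsWithin : Ioi (0 : ℝ) ∈ 𝓝[>] 0)).exists
  exact exists_isMIntegralCurve_of_isMIntegralCurveOn (hV.of_le (by norm_cast)) ha0
    (fun x => ha x (mem_univ x)) w

variable [CompactSpace M] [T2Space M]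

theorem isMIntegralCurve_flow
    (hV : ContMDiff (𝓡 n) (𝓡 n).tangent ∞ (fun w => (⟨w, V w⟩ : TangentBundle (𝓡 n) M)))
    (w : M) : IsMIntegralCurve (I := 𝓡 n) (flow V · w) V := by
  obtain ⟨γ, rfl, hγ⟩ := exists_isMIntegralCurve hV w
  simpa only [flow_eq hV hγ] using hγ

theorem flow_zero
    (hV : ContMDiff (𝓡 n) (𝓡 n).tangent ∞ (fun w => (⟨w, V w⟩ : TangentBundle (𝓡 n) M)))
    (w : M) : flow V 0 w = w := by
  obtain ⟨γ, rfl, hγ⟩ := exists_isMIntegralCurve hV w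
  exact flow_eq hV hγ 0

theorem flow_add
    (hV : ContMDiff (𝓡 n) (𝓡 n).tangent ∞ (fun w => (⟨w, V w⟩ : TangentBundle (𝓡 n) M)))
    (s t : ℝ) (w : M) : flow V (s + t) w = flow V s (flow V t w) := by
  have := flow_eq hV ((isMIntegralCurve_flow hV w).comp_add t) s
  simpa using this.symm

/-- Near every point and for small times, the flow is given by a local flow in a chart. -/
theorem eventually_flow_eq_chartFlow
    (hV : ContMDiff (𝓡 n) (𝓡 n).tangent ∞ (fun w => (⟨w, V w⟩ : TangentBundle (𝓡 n) M)))
    {x₀ : M} {ε r : ℝ} {φ : ℝ → EuclideanSpace ℝ (Fin n) → EuclideanSpace ℝ (Fin n)}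
    {A : ℝ → EuclideanSpace ℝ (Fin n) → EuclideanSpace ℝ (Fin n) →L[ℝ] EuclideanSpace ℝ (Fin n)}
    (h : IsLocalFlow (chartField x₀ V) (extChartAt (𝓡 n) x₀ x₀)
      (extChartAt (𝓡 n) x₀).target ε r φ A) :
    ∀ᶠ q : ℝ × M in 𝓝 (0, x₀), q.1 ∈ Ioo (-ε) ε ∧ q.2 ∈ chartBall n x₀ r ∧
      ↿(flow V) =ᶠ[𝓝 q] ↿(chartFlow x₀ φ) ∧ flow V q.1 =ᶠ[𝓝 q.2] chartFlow x₀ φ q.1 := by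
  have hε := h.time_pos
  have h0 : (0 : ℝ) ∈ Ioo (-ε) ε := ⟨by linarith, hε⟩
  have hmem : ∀ᶠ q : ℝ × M in 𝓝 (0, x₀), q.1 ∈ Ioo (-ε) ε ∧ q.2 ∈ chartBall n x₀ r :=
    prod_mem_nhds (Ioo_mem_nhds h0.1 h0.2) (chartBall_mem_nhds h.radius_pos)
  -- Both are integral curves of `V` on `(-ε, ε)` from the same point, hence equal.
  have heq : ∀ᶠ q : ℝ × M in 𝓝 (0, x₀), ↿(flow V) q = ↿(chartFlow x₀ φ) q := by
    filter_upwards [hmem] with q hq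
    exact isMIntegralCurveOn_Ioo_eqOn_of_contMDiff_boundaryless h0 (hV.of_le (by norm_cast))
      ((isMIntegralCurve_flow hV q.2).isMIntegralCurveOn _) (h.isMIntegralCurveOn_chartFlow hq.2)
      (by rw [flow_zero hV, h.chartFlow_zero hq.2]) hq.1
  filter_upwards [hmem, eventually_eventually_nhds.2 heq] with q hq hq'
  refine ⟨hq.1, hq.2, hq', ?_⟩
  have hc : Filter.Tendsto (fun w : M => (q.1, w)) (𝓝 q.2) (𝓝 q) :=
    (Continuous.prodMk_right q.1).tendsto q.2
  exact hc.eventually hq'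

theorem eventually_contMDiffAt_flow
    (hV : ContMDiff (𝓡 n) (𝓡 n).tangent ∞ (fun w => (⟨w, V w⟩ : TangentBundle (𝓡 n) M)))
    (x₀ : M) : ∀ᶠ q : ℝ × M in 𝓝 (0, x₀),
      ContMDiffAt (𝓘(ℝ, ℝ).prod (𝓡 n)) (𝓡 n) 1 ↿(flow V) q := by
  obtain ⟨ε, r, φ, A, h, hA, hφ, -⟩ := exists_chartFlow hV x₀
  filter_upwards [eventually_flow_eq_chartFlow hV h] with q ⟨ht, hw, heq, _⟩
  exact (h.contMDiffAt_chartFlow hφ ht hw).congr_of_eventuallyEq heq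

/-- For small times the chart description holds uniformly by compactness; the group law then reaches
all times. Orientation and invariance of fields follow the same pattern. -/
theorem contMDiff_flow_left
    (hV : ContMDiff (𝓡 n) (𝓡 n).tangent ∞ (fun w => (⟨w, V w⟩ : TangentBundle (𝓡 n) M)))
    (t : ℝ) : ContMDiff (𝓡 n) (𝓡 n) 1 (flow V t) := by
  refine forall_real_of_eventually_zero (Q := fun t => ContMDiff (𝓡 n) (𝓡 n) 1 (flow V t)) ?_
    (fun s t hs ht => ?_) t
  · refine (isCompact_univ.eventually_forall_of_forall_eventually
      (P := fun t w => ContMDiffAt (𝓘(ℝ, ℝ).prod (𝓡 n)) (𝓡 n) 1 ↿(flow V) (t, w))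
      (fun x _ => eventually_contMDiffAt_flow hV x)).mono fun t ht w => ?_
    exact ContMDiffAt.comp (g := ↿(flow V)) (f := fun w => (t, w)) w (ht w (mem_univ w))
      (contMDiffAt_const.prodMk contMDiffAt_id)
  · have : flow V (s + t) = flow V s ∘ flow V t := funext fun w => flow_add hV s t w
    rw [this]
    exact hs.comp ht

/-- The flow of a smooth vector field on a compact manifold is jointly `C¹` in time and space. -/
theorem contMDiff_flow
    (hV : ContMDiff (𝓡 n) (𝓡 n).tangent ∞ (fun w => (⟨w, V w⟩ : TangentBundle (𝓡 n) M))) :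
    ContMDiff (𝓘(ℝ, ℝ).prod (𝓡 n)) (𝓡 n) 1 ↿(flow V) := by
  rintro ⟨t₀, w₀⟩
  -- The group law moves the question to time `0`, where the local result applies.
  have heq : ↿(flow V) = ↿(flow V) ∘ fun q : ℝ × M => (q.1 - t₀, flow V t₀ q.2) := by
    ext ⟨t, w⟩
    simp only [HasUncurry.uncurry, comp_apply, id_eq]
    rw [← flow_add hV, sub_add_cancel]
  rw [heq]
  refine ContMDiffAt.comp (t₀, w₀) ?_ (ContMDiffAt.prodMk
    (contMDiffAt_fst.sub contMDiffAt_const)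
    (ContMDiffAt.comp (t₀, w₀) (contMDiff_flow_left hV t₀ w₀) contMDiffAt_snd))
  simp only [sub_self]
  exact (eventually_contMDiffAt_flow hV (flow V t₀ w₀)).self_of_nhds

theorem mdifferentiableAt_flow_left
    (hV : ContMDiff (𝓡 n) (𝓡 n).tangent ∞ (fun w => (⟨w, V w⟩ : TangentBundle (𝓡 n) M)))
    (t : ℝ) (w : M) : MDifferentiableAt (𝓡 n) (𝓡 n) (flow V t) w :=
  (contMDiff_flow_left hV t w).mdifferentiableAt (by simp)

/-- The flow preserves orientations, being isotopic to the identity. -/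
theorem preservesOrientationAt_flow
    (hV : ContMDiff (𝓡 n) (𝓡 n).tangent ∞ (fun w => (⟨w, V w⟩ : TangentBundle (𝓡 n) M)))
    (o : ManifoldOrientation n M) (t : ℝ) (w : M) : PreservesOrientationAt o o (flow V t) w := by
  refine forall_real_of_eventually_zero
    (Q := fun t => ∀ w, PreservesOrientationAt o o (flow V t) w) ?_ (fun s t hs ht w => ?_) t w
  · refine (isCompact_univ.eventually_forall_of_forall_eventually
      (P := fun t w => PreservesOrientationAt o o (flow V t) w)
      (fun x _ => ?_)).mono fun t ht w => ht w (mem_univ w)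
    obtain ⟨ε, r, φ, A, h, hA, hφ, -⟩ := exists_chartFlow hV x
    filter_upwards [eventually_flow_eq_chartFlow hV h,
      h.eventually_preservesOrientationAt_chartFlow o hA hφ] with q ⟨_, _, _, heq⟩ ho
    exact ho.congr heq
  · have : flow V (s + t) = flow V s ∘ flow V t := funext fun w => flow_add hV s t w
    rw [this]
    exact (hs _).comp (ht w) (mdifferentiableAt_flow_left hV s _)
      (mdifferentiableAt_flow_left hV t w)

/-- If the Lie bracket of `V` and `Y` vanishes, then the flow of `V` carries `Y` to itself. -/
theorem mfderiv_flow_apply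
    (hV : ContMDiff (𝓡 n) (𝓡 n).tangent ∞ (fun w => (⟨w, V w⟩ : TangentBundle (𝓡 n) M)))
    (hY : ContMDiff (𝓡 n) (𝓡 n).tangent ∞ (fun w => (⟨w, Y w⟩ : TangentBundle (𝓡 n) M)))
    (hVY : mlieBracket (𝓡 n) V Y = 0) (t : ℝ) (w : M) :
    mfderiv (𝓡 n) (𝓡 n) (flow V t) w (Y w) = Y (flow V t w) := by
  refine forall_real_of_eventually_zero
    (Q := fun t => ∀ w, mfderiv (𝓡 n) (𝓡 n) (flow V t) w (Y w) = Y (flow V t w)) ?_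
    (fun s t hs ht w => ?_) t w
  · refine (isCompact_univ.eventually_forall_of_forall_eventually
      (P := fun t w => mfderiv (𝓡 n) (𝓡 n) (flow V t) w (Y w) = Y (flow V t w))
      (fun x _ => ?_)).mono fun t ht w => ht w (mem_univ w)
    obtain ⟨ε, r, φ, A, h, hA, -, hg⟩ := exists_chartFlow hV x
    filter_upwards [eventually_flow_eq_chartFlow hV h] with q ⟨ht, hw, _, heq⟩
    have := h.mfderiv_chartFlow_apply (Y := Y) hA ht hw (hg _
      (fun y hy => (contDiffAt_chartField hY hy).differentiableAt (by simp))
      (fun y hy => fderiv_chartField_apply_comm hV hY hVY hy) _ ht _ hw.2)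
    rw [heq.mfderiv_eq, heq.eq_of_nhds]
    exact this
  · have : flow V (s + t) = flow V s ∘ flow V t := funext fun w => flow_add hV s t w
    rw [this, mfderiv_comp w (mdifferentiableAt_flow_left hV s _)
      (mdifferentiableAt_flow_left hV t w)]
    refine Eq.trans ?_ (hs (flow V t w))
    exact congrArg _ (ht w)

end GlobalFlow

/-! ### Differentiability of inverses, and composition -/

section Inverse

open Set Metric Function

variable {n : ℕ} {M : Type*} [TopologicalSpace M] [ChartedSpace (EuclideanSpace ℝ (Fin n)) M]
  {N : Type*} [TopologicalSpace N] [ChartedSpace (EuclideanSpace ℝ (Fin n)) N]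
  {P : Type*} [TopologicalSpace P] [ChartedSpace (EuclideanSpace ℝ (Fin n)) P]

/-- A homeomorphism read in the charts around `x` and `y`. -/
noncomputable def chartRead (Φ : M ≃ₜ N) (x : M) (y : N) :
    OpenPartialHomeomorph (EuclideanSpace ℝ (Fin n)) (EuclideanSpace ℝ (Fin n)) :=
  (chartAt (EuclideanSpace ℝ (Fin n)) x).symm.trans
    (Φ.toOpenPartialHomeomorph.trans (chartAt (EuclideanSpace ℝ (Fin n)) y))

theorem chartRead_coe (Φ : M ≃ₜ N) (x : M) (y : N) :
    ⇑(chartRead Φ x y) = extChartAt (𝓡 n) y ∘ Φ ∘ (extChartAt (𝓡 n) x).symm := rfl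

theorem chartRead_symm_coe (Φ : M ≃ₜ N) (x : M) (y : N) :
    ⇑(chartRead Φ x y).symm = extChartAt (𝓡 n) x ∘ Φ.symm ∘ (extChartAt (𝓡 n) y).symm := rfl

theorem mem_chartRead_target (Φ : M ≃ₜ N) (y : N) :
    extChartAt (𝓡 n) y y ∈ (chartRead Φ (Φ.symm y) y).target := by
  simp [chartRead]

theorem chartRead_symm_apply (Φ : M ≃ₜ N) (y : N) :
    (chartRead Φ (Φ.symm y) y).symm (extChartAt (𝓡 n) y y) =
      extChartAt (𝓡 n) (Φ.symm y) (Φ.symm y) := by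
  rw [chartRead_symm_coe]
  simp

variable [IsManifold (𝓡 n) ∞ M] [IsManifold (𝓡 n) ∞ N] [IsManifold (𝓡 n) ∞ P]

theorem hasFDerivAt_chartRead (Φ : M ≃ₜ N) (y : N)
    (hd : MDifferentiableAt (𝓡 n) (𝓡 n) Φ (Φ.symm y))
    (hi : (mfderiv (𝓡 n) (𝓡 n) Φ (Φ.symm y)).IsInvertible) :
    ∃ e : EuclideanSpace ℝ (Fin n) ≃L[ℝ] EuclideanSpace ℝ (Fin n),
      HasFDerivAt (chartRead Φ (Φ.symm y) y)
        (e : EuclideanSpace ℝ (Fin n) →L[ℝ] EuclideanSpace ℝ (Fin n))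
        ((chartRead Φ (Φ.symm y) y).symm (extChartAt (𝓡 n) y y)) := by
  rw [chartRead_symm_apply, chartRead_coe]
  set x := Φ.symm y with hx
  have hxy : Φ x = y := Φ.apply_symm_apply y
  have hxt := mem_extChartAt_target (I := 𝓡 n) x
  have hl : (extChartAt (𝓡 n) x).symm (extChartAt (𝓡 n) x x) = x := extChartAt_to_inv x
  have h1 := ((contMDiffAt_extChartAt_symm_of_mem hxt).mdifferentiableAt (by simp)).hasMFDerivAt
  have i1 := isInvertible_mfderiv_extChartAt_symm hxt
  have hs : Φ x ∈ (extChartAt (𝓡 n) y).source := by rw [hxy]; exact mem_extChartAt_source y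
  have h3 := (mdifferentiableAt_extChartAt (I := 𝓡 n) (x := y) (y := Φ x)
    (by simpa using hs)).hasMFDerivAt
  have i3 := isInvertible_mfderiv_extChartAt (I := 𝓡 n) hs
  -- Base points are rewritten as images under the inverse chart so that the three derivatives are
  -- composable.
  rw [← hl] at hd hi h3 i3
  have h := HasMFDerivAt.comp (extChartAt (𝓡 n) x x) h3
    (HasMFDerivAt.comp (extChartAt (𝓡 n) x x) hd.hasMFDerivAt h1)
  obtain ⟨e, he⟩ := i3.comp (hi.comp i1)
  refine ⟨e, ?_⟩
  have := hasMFDerivAt_iff_hasFDerivAt.1 h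
  rw [← he] at this
  exact this

/-- The inverse of a homeomorphism is differentiable where the derivative is invertible. -/
theorem mdifferentiableAt_homeomorph_symm (Φ : M ≃ₜ N) (y : N)
    (hd : MDifferentiableAt (𝓡 n) (𝓡 n) Φ (Φ.symm y))
    (hi : (mfderiv (𝓡 n) (𝓡 n) Φ (Φ.symm y)).IsInvertible) :
    MDifferentiableAt (𝓡 n) (𝓡 n) Φ.symm y := by
  obtain ⟨e, he⟩ := hasFDerivAt_chartRead Φ y hd hi
  rw [mdifferentiableAt_iff]
  refine ⟨Φ.symm.continuous.continuousAt, ?_⟩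
  exact ((chartRead Φ (Φ.symm y) y).hasFDerivAt_symm
    (mem_chartRead_target Φ y) he).differentiableAt.differentiableWithinAt

/-- The inverse of a `C¹` homeomorphism is `C¹` where the derivative is invertible. -/
theorem contMDiffAt_homeomorph_symm (Φ : M ≃ₜ N) (y : N)
    (hd : ContMDiffAt (𝓡 n) (𝓡 n) 1 Φ (Φ.symm y))
    (hi : (mfderiv (𝓡 n) (𝓡 n) Φ (Φ.symm y)).IsInvertible) :
    ContMDiffAt (𝓡 n) (𝓡 n) 1 Φ.symm y := by
  obtain ⟨e, he⟩ := hasFDerivAt_chartRead Φ y (hd.mdifferentiableAt (by simp)) hi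
  have hc : ContDiffAt ℝ 1 (chartRead Φ (Φ.symm y) y)
      ((chartRead Φ (Φ.symm y) y).symm (extChartAt (𝓡 n) y y)) := by
    rw [chartRead_symm_apply, chartRead_coe]
    have := (contMDiffAt_iff.1 hd).2
    rw [ModelWithCorners.range_eq_univ, contDiffWithinAt_univ, Φ.apply_symm_apply] at this
    exact this
  rw [contMDiffAt_iff]
  refine ⟨Φ.symm.continuous.continuousAt, ?_⟩
  exact ((chartRead Φ (Φ.symm y) y).contDiffAt_symm
    (mem_chartRead_target Φ y) he hc).contDiffWithinAt

variable {oM : ManifoldOrientation n M} {oN : ManifoldOrientation n N}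
  {oP : ManifoldOrientation n P}

theorem PreservesOrientationAt.isInvertible {f : M → N} {x : M}
    (h : PreservesOrientationAt oM oN f x) : (mfderiv (𝓡 n) (𝓡 n) f x).IsInvertible := by
  obtain ⟨e, he, -⟩ := h
  exact ⟨e, he⟩

/-- Continuity of the inverse comes from compactness, not from the inverse function theorem, which
would require `f` to be `C¹`. -/
theorem isOrientedDifferentiableIso_of_bijective [CompactSpace M] [T2Space N] {f : M → N}
    (hb : Bijective f) (hd : MDifferentiable (𝓡 n) (𝓡 n) f) (ho : PreservesOrientation oM oN f) :
    IsOrientedDifferentiableIso oM oN f := by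
  let Φ : M ≃ₜ N := Continuous.homeoOfEquivCompactToT2 (f := Equiv.ofBijective f hb) hd.continuous
  exact ⟨⟨Φ, rfl, hd, fun y => mdifferentiableAt_homeomorph_symm Φ y (hd _)
    (PreservesOrientationAt.isInvertible (ho _))⟩, ho⟩

theorem IsOrientedDifferentiableIso.isOrientedDiffeo {f : M → N}
    (h : IsOrientedDifferentiableIso oM oN f) (hf : ContMDiff (𝓡 n) (𝓡 n) 1 f) :
    IsOrientedDiffeo oM oN f := by
  obtain ⟨⟨Φ, rfl, -⟩, ho⟩ := h
  exact ⟨⟨⟨Φ.toEquiv, hf, fun y => contMDiffAt_homeomorph_symm Φ y (hf _)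
    (PreservesOrientationAt.isInvertible (ho _))⟩, rfl⟩, ho⟩

theorem IsOrientedDiffeo.isOrientedDifferentiableIso {f : M → N}
    (h : IsOrientedDiffeo oM oN f) : IsOrientedDifferentiableIso oM oN f := by
  obtain ⟨⟨Φ, rfl⟩, ho⟩ := h
  exact ⟨⟨Φ.toHomeomorph, rfl, Φ.mdifferentiable (by simp), Φ.symm.mdifferentiable (by simp)⟩, ho⟩

theorem IsOrientedDifferentiableIso.comp {g : N → P} {f : M → N}
    (hg : IsOrientedDifferentiableIso oN oP g) (hf : IsOrientedDifferentiableIso oM oN f) :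
    IsOrientedDifferentiableIso oM oP (g ∘ f) := by
  obtain ⟨⟨Φ, rfl, h1, h2⟩, ho⟩ := hf
  obtain ⟨⟨Ψ, rfl, h1', h2'⟩, ho'⟩ := hg
  exact ⟨⟨Φ.trans Ψ, rfl, h1'.comp h1, h2.comp h2'⟩, fun x =>
    PreservesOrientationAt.comp (ho' (Φ x)) (ho x) (h1' _) (h1 _)⟩

theorem IsOrientedDiffeo.comp {g : N → P} {f : M → N}
    (hg : IsOrientedDiffeo oN oP g) (hf : IsOrientedDiffeo oM oN f) :
    IsOrientedDiffeo oM oP (g ∘ f) := by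
  obtain ⟨⟨Φ, rfl⟩, ho⟩ := hf
  obtain ⟨⟨Ψ, rfl⟩, ho'⟩ := hg
  exact ⟨⟨Φ.trans Ψ, rfl⟩, fun x => PreservesOrientationAt.comp (ho' (Φ x)) (ho x)
    (Ψ.mdifferentiable (by simp) _) (Φ.mdifferentiable (by simp) _)⟩

theorem isOrientedDiffeo_id : IsOrientedDiffeo oM oM id :=
  ⟨⟨Diffeomorph.refl _ M 1, rfl⟩, fun x => preservesOrientationAt_id x⟩

end Inverse

/-! ### Finite compositions -/

section SeqComp

variable {W : Type*} {p : ℕ}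

theorem seqComp_zero (h : Fin 0 → W → W) : seqComp h = id :=
  funext fun w => Fin.foldl_zero _ w

theorem seqComp_succ (h : Fin (p + 1) → W → W) :
    seqComp h = h (Fin.last p) ∘ seqComp fun m => h m.castSucc :=
  funext fun w => Fin.foldl_succ_last _ w

/-- A property of maps that holds for the identity and passes to compositions passes to
`seqComp`. -/
theorem seqComp_induction {Q : (W → W) → Prop} (hid : Q id)
    (hcomp : ∀ g f, Q g → Q f → Q (g ∘ f)) (h : Fin p → W → W) (hh : ∀ m, Q (h m)) :
    Q (seqComp h) := by
  induction p with
  | zero => rw [seqComp_zero]; exact hid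
  | succ p ih =>
    rw [seqComp_succ]
    exact hcomp _ _ (hh _) (ih _ fun m => hh _)

end SeqComp

/-! ### A single channel: the flow with variable time -/

section Channel

open Set Metric Function VectorField

variable {n : ℕ} {M : Type*} [TopologicalSpace M] [ChartedSpace (EuclideanSpace ℝ (Fin n)) M]

/-- The derivative of a real function, as a functional on the tangent space. -/
noncomputable def differential (u : M → ℝ) (w : M) : TangentSpace (𝓡 n) w →L[ℝ] ℝ :=
  mfderiv (𝓡 n) 𝓘(ℝ, ℝ) u w

variable [IsManifold (𝓡 n) ∞ M] [CompactSpace M] [T2Space M]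
  {V : ∀ w : M, TangentSpace (𝓡 n) w}

/-- The joint derivative of the flow in time and space. -/
theorem mfderiv_uncurry_flow_apply
    (hV : ContMDiff (𝓡 n) (𝓡 n).tangent ∞ (fun w => (⟨w, V w⟩ : TangentBundle (𝓡 n) M)))
    (t : ℝ) (w : M) (s : ℝ) (v : TangentSpace (𝓡 n) w) :
    mfderiv (𝓘(ℝ, ℝ).prod (𝓡 n)) (𝓡 n) ↿(flow V) (t, w) ((s, v) : ℝ × TangentSpace (𝓡 n) w) =
      s • V (flow V t w) + mfderiv (𝓡 n) (𝓡 n) (flow V t) w v := by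
  refine (mfderiv_prod_eq_add_apply (f := ↿(flow V)) (p := (t, w))
    ((contMDiff_flow hV (t, w)).mdifferentiableAt (by simp))).trans ?_
  congr 1
  exact congrArg (fun L => L s) (isMIntegralCurve_flow hV w t).mfderiv

/-- The derivative of the flow with variable flow time `u`. -/
theorem hasMFDerivAt_flow_time
    (hV : ContMDiff (𝓡 n) (𝓡 n).tangent ∞ (fun w => (⟨w, V w⟩ : TangentBundle (𝓡 n) M)))
    {u : M → ℝ} {w : M} (hu : MDifferentiableAt (𝓡 n) 𝓘(ℝ, ℝ) u w) :
    HasMFDerivAt (𝓡 n) (𝓡 n) (fun w => flow V (u w) w) w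
      ((mfderiv (𝓡 n) (𝓡 n) (flow V (u w)) w).comp
        (.id ℝ _ + (differential u w).smulRight (V w))) := by
  have h1 := ((contMDiff_flow hV (u w, w)).mdifferentiableAt (by simp)).hasMFDerivAt
  have h := HasMFDerivAt.comp (g := ↿(flow V)) (f := fun w => (u w, w)) w h1
    (hu.hasMFDerivAt.prodMk (hasMFDerivAt_id w))
  refine h.congr_mfderiv ?_
  refine ContinuousLinearMap.ext fun v => ?_
  refine (mfderiv_uncurry_flow_apply hV (u w) w (differential u w v) v).trans ?_
  -- As `V` commutes with itself, the time derivative `V (flow V t w)` is the image of `V w`, and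
  -- the derivative of the flow factors out.
  rw [← mfderiv_flow_apply hV hV mlieBracket_self]
  change _ = mfderiv (𝓡 n) (𝓡 n) (flow V (u w)) w (v + differential u w v • V w)
  rw [map_add, map_smul, add_comm]

/-- Adding a rank one map to the identity preserves orientations if the determinant is
positive. -/
theorem exists_transvection_map_orientation (α : EuclideanSpace ℝ (Fin n) →L[ℝ] ℝ)
    (v : EuclideanSpace ℝ (Fin n)) (h : 0 < 1 + α v)
    (o : Orientation ℝ (EuclideanSpace ℝ (Fin n)) (Fin n)) :
    ∃ e : EuclideanSpace ℝ (Fin n) ≃L[ℝ] EuclideanSpace ℝ (Fin n),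
      (e : EuclideanSpace ℝ (Fin n) →L[ℝ] EuclideanSpace ℝ (Fin n)) = .id ℝ _ + α.smulRight v ∧
      Orientation.map (Fin n) e.toLinearEquiv o = o := by
  have hB : 0 < (.id ℝ _ + α.smulRight v :
      EuclideanSpace ℝ (Fin n) →L[ℝ] EuclideanSpace ℝ (Fin n)).det := by
    have hdet := LinearMap.transvection.det (α : EuclideanSpace ℝ (Fin n) →ₗ[ℝ] ℝ) v
    exact h.trans_eq hdet.symm
  refine ⟨ContinuousLinearMap.toContinuousLinearEquivOfDetNeZero _ hB.ne', ?_, ?_⟩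
  · ext x; rfl
  · exact (Orientation.map_eq_iff_det_pos o _ (by simp)).2 hB

theorem preservesOrientationAt_flow_time
    (hV : ContMDiff (𝓡 n) (𝓡 n).tangent ∞ (fun w => (⟨w, V w⟩ : TangentBundle (𝓡 n) M)))
    (o : ManifoldOrientation n M) {u : M → ℝ} {w : M}
    (hu : MDifferentiableAt (𝓡 n) 𝓘(ℝ, ℝ) u w) (h : 0 < 1 + differential u w (V w)) :
    PreservesOrientationAt o o (fun w => flow V (u w) w) w := by
  obtain ⟨e, he, heo⟩ := preservesOrientationAt_flow hV o (u w) w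
  obtain ⟨e', he', heo'⟩ := exists_transvection_map_orientation (differential u w) (V w) h
    (o.orient w)
  refine ⟨ContinuousLinearEquiv.trans e' e, ?_, ?_⟩
  · rw [(hasMFDerivAt_flow_time hV hu).mfderiv, ← he]
    exact ContinuousLinearMap.ext fun v => congrArg e (DFunLike.congr_fun he' v)
  · refine (orientation_map_trans e'.toLinearEquiv e.toLinearEquiv (o.orient w)).trans ?_
    exact (congrArg (Orientation.map (Fin n) e.toLinearEquiv) heo').trans heo

theorem hasDerivAt_comp_flow
    (hV : ContMDiff (𝓡 n) (𝓡 n).tangent ∞ (fun w => (⟨w, V w⟩ : TangentBundle (𝓡 n) M)))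
    {u : M → ℝ} {t : ℝ} {w : M} (hu : MDifferentiableAt (𝓡 n) 𝓘(ℝ, ℝ) u (flow V t w)) :
    HasDerivAt (fun t => u (flow V t w))
      (differential u (flow V t w) (V (flow V t w))) t := by
  have h := HasMFDerivAt.comp (g := u) (f := fun t => flow V t w) t hu.hasMFDerivAt
    (isMIntegralCurve_flow hV w t)
  have h' : HasFDerivAt (fun t => u (flow V t w)) ((differential u (flow V t w)).comp
      ((1 : ℝ →L[ℝ] ℝ).smulRight (V (flow V t w)))) t := hasMFDerivAt_iff_hasFDerivAt.1 h
  refine h'.hasDerivAt.congr_deriv ?_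
  exact congrArg (differential u (flow V t w)) (one_smul ℝ _)

/-- The map `w ↦ flow V (u w) w` sends the point with parameter `t` on the flow line of `w` to the
one with parameter `t + u (flow V t w)`. -/
theorem strictMono_add_comp_flow
    (hV : ContMDiff (𝓡 n) (𝓡 n).tangent ∞ (fun w => (⟨w, V w⟩ : TangentBundle (𝓡 n) M)))
    {u : M → ℝ} (hu : MDifferentiable (𝓡 n) 𝓘(ℝ, ℝ) u)
    (h : ∀ w, 0 < 1 + differential u w (V w)) (w : M) :
    StrictMono fun t => t + u (flow V t w) :=
  strictMono_of_hasDerivAt_pos (fun t => (hasDerivAt_id t).add (hasDerivAt_comp_flow hV (hu _)))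
    fun t => h (flow V t w)

/-- Flowing for a time that grows along the flow lines with a rate above `-1` is bijective. -/
theorem bijective_flow_time
    (hV : ContMDiff (𝓡 n) (𝓡 n).tangent ∞ (fun w => (⟨w, V w⟩ : TangentBundle (𝓡 n) M)))
    {u : M → ℝ} (hu : MDifferentiable (𝓡 n) 𝓘(ℝ, ℝ) u)
    (h : ∀ w, 0 < 1 + differential u w (V w)) : Bijective fun w => flow V (u w) w := by
  constructor
  · intro w w' hww
    -- Two points with the same image lie on one flow line. At this parameter the increasing
    -- function takes the value `u w`, as it does at `0`.
    have hw' : w' = flow V (-(u w') + u w) w := by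
      rw [flow_add hV]
      refine Eq.trans ?_ (congrArg (flow V (-(u w'))) hww.symm)
      rw [← flow_add hV, neg_add_cancel, flow_zero hV]
    have hu' : -(u w') + u w = 0 := by
      apply (strictMono_add_comp_flow hV hu h w).injective
      simp only
      rw [← hw', flow_zero hV]
      ring
    rw [hw', hu', flow_zero hV]
  · intro w
    -- With `|u| ≤ C`, the function `t + u (flow V t w)` changes sign between `-C` and `C`; at a
    -- zero, the point `flow V t w` is mapped to `w`.
    obtain ⟨C, hC⟩ := isCompact_univ.exists_bound_of_continuousOn hu.continuous.continuousOn
    have hcont : Continuous fun t => t + u (flow V t w) :=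
      continuous_id.add (hu.continuous.comp (isMIntegralCurve_flow hV w).continuous)
    obtain ⟨t, ht⟩ := mem_range_of_exists_le_of_exists_ge (c := 0) hcont
      ⟨-C, by linarith [abs_le.1 (hC (flow V (-C) w) (mem_univ _))]⟩
      ⟨C, by linarith [abs_le.1 (hC (flow V C w) (mem_univ _))]⟩
    refine ⟨flow V t w, ?_⟩
    simp only
    rw [← flow_add hV, add_comm]
    exact (congrArg (flow V · w) ht).trans (flow_zero hV w)

theorem isOrientedDifferentiableIso_flow_time
    (hV : ContMDiff (𝓡 n) (𝓡 n).tangent ∞ (fun w => (⟨w, V w⟩ : TangentBundle (𝓡 n) M)))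
    (o : ManifoldOrientation n M) {u : M → ℝ} (hu : MDifferentiable (𝓡 n) 𝓘(ℝ, ℝ) u)
    (h : ∀ w, 0 < 1 + differential u w (V w)) :
    IsOrientedDifferentiableIso o o fun w => flow V (u w) w :=
  isOrientedDifferentiableIso_of_bijective (bijective_flow_time hV hu h)
    (fun w => (hasMFDerivAt_flow_time hV (hu w)).mdifferentiableAt)
    fun w => preservesOrientationAt_flow_time hV o (hu w) (h w)

theorem contMDiff_flow_time
    (hV : ContMDiff (𝓡 n) (𝓡 n).tangent ∞ (fun w => (⟨w, V w⟩ : TangentBundle (𝓡 n) M)))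
    {u : M → ℝ} (hu : ContMDiff (𝓡 n) 𝓘(ℝ, ℝ) 1 u) :
    ContMDiff (𝓡 n) (𝓡 n) 1 fun w => flow V (u w) w :=
  (contMDiff_flow hV).comp (hu.prodMk contMDiff_id)

end Channel

/-! ### Commuting flows and the joint exponential -/

section CommutingFlows

open Set Metric Function VectorField

variable {n p : ℕ} {M : Type*} [TopologicalSpace M] [ChartedSpace (EuclideanSpace ℝ (Fin n)) M]
  [IsManifold (𝓡 n) ∞ M] [CompactSpace M] [T2Space M]

/-- If the flow of `V` carries `X` to itself and `γ` is an integral curve of `X`, then moving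
`γ` along the flow of `V` gives an integral curve of `X + a • V`. -/
theorem isMIntegralCurve_flow_comp {V X : ∀ w : M, TangentSpace (𝓡 n) w}
    (hV : ContMDiff (𝓡 n) (𝓡 n).tangent ∞ (fun w => (⟨w, V w⟩ : TangentBundle (𝓡 n) M)))
    (hVX : ∀ t w, mfderiv (𝓡 n) (𝓡 n) (flow V t) w (X w) = X (flow V t w))
    {γ : ℝ → M} (hγ : IsMIntegralCurve (I := 𝓡 n) γ X) (a : ℝ) :
    IsMIntegralCurve (I := 𝓡 n) (fun t => flow V (t * a) (γ t)) (X + a • V) := by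
  intro t
  have h1 := ((contMDiff_flow hV (t * a, γ t)).mdifferentiableAt (by simp)).hasMFDerivAt
  have h2 : HasMFDerivAt 𝓘(ℝ, ℝ) 𝓘(ℝ, ℝ) (fun t : ℝ => t * a) t
      ((1 : ℝ →L[ℝ] ℝ).smulRight a) := by
    refine hasMFDerivAt_iff_hasFDerivAt.2 ?_
    have := (hasDerivAt_mul_const a (x := t)).hasFDerivAt
    exact this.congr_fderiv (ContinuousLinearMap.ext_ring rfl)
  have h := HasMFDerivAt.comp (g := ↿(flow V)) (f := fun t => (t * a, γ t)) t h1
    (h2.prodMk (hγ t))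
  refine h.congr_mfderiv (ContinuousLinearMap.ext_ring ?_)
  refine (mfderiv_uncurry_flow_apply hV (t * a) (γ t) ((1 : ℝ) • a) ((1 : ℝ) • X (γ t))).trans ?_
  rw [one_smul, one_smul, hVX, add_comm]
  exact (one_smul ℝ _).symm

variable {V : Fin p → ∀ w : M, TangentSpace (𝓡 n) w}

/-- By induction: the last flow carries each earlier field, hence their weighted sum, to itself, so
composing with it adds the last summand. -/
theorem isMIntegralCurve_seqComp_flow
    (hV : ∀ m, ContMDiff (𝓡 n) (𝓡 n).tangent ∞
      (fun w => (⟨w, V m w⟩ : TangentBundle (𝓡 n) M)))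
    (hcomm : ∀ i j, i ≠ j → mlieBracket (𝓡 n) (V i) (V j) = 0) (a : Fin p → ℝ) (w : M) :
    IsMIntegralCurve (I := 𝓡 n) (fun t => seqComp (fun m => flow (V m) (t * a m)) w)
      (∑ m, a m • V m) := by
  induction p with
  | zero =>
    simp only [seqComp_zero, id_eq, Finset.univ_eq_empty, Finset.sum_empty]
    exact isMIntegralCurve_const rfl
  | succ p ih =>
    simp only [seqComp_succ, comp_apply, Fin.sum_univ_castSucc]
    refine isMIntegralCurve_flow_comp (hV _) (fun t z => ?_)
      (ih (fun m => hV m.castSucc) (fun i j hij => hcomm _ _ (by simpa using hij))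
        (fun m => a m.castSucc)) (a (Fin.last p))
    simp only [Finset.sum_apply, Pi.smul_apply, map_sum, map_smul]
    exact Finset.sum_congr rfl fun m _ => by
      rw [mfderiv_flow_apply (hV _) (hV _) (hcomm _ _ (Fin.castSucc_lt_last m).ne')]

/-- The exponential of a sum of commuting vector fields is the composition of the
exponentials. -/
theorem vexp_sum_eq_seqComp
    (hV : ∀ m, ContMDiff (𝓡 n) (𝓡 n).tangent ∞
      (fun w => (⟨w, V m w⟩ : TangentBundle (𝓡 n) M)))
    (hcomm : ∀ i j, i ≠ j → mlieBracket (𝓡 n) (V i) (V j) = 0) (a : Fin p → ℝ) :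
    vexp (∑ m, a m • V m) = seqComp fun m => vexp (a m • V m) := by
  funext w
  have hsum : ContMDiff (𝓡 n) (𝓡 n).tangent ∞
      (fun w => (⟨w, (∑ m, a m • V m) w⟩ : TangentBundle (𝓡 n) M)) := by
    have := ContMDiff.sum_section (I := 𝓡 n) (n := ∞) (s := Finset.univ)
      (t := fun m => a m • V m) fun m _ => (hV m).const_smul_section (a := a m)
    simpa only [Finset.sum_apply] using this
  have h := vexp_eq hsum (isMIntegralCurve_seqComp_flow hV hcomm a w)
  have h0 : seqComp (fun m => flow (V m) (0 * a m)) w = w := by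
    refine congrFun (seqComp_induction (Q := fun f => f = id) rfl
      (fun _ _ hg hf => by rw [hg, hf]; rfl) _ fun m => ?_) w
    funext z
    rw [zero_mul, flow_zero (hV m)]
    rfl
  rw [h0] at h
  simp only [one_mul] at h
  exact h

/-- A function that is invariant under all channels is invariant under their composition. -/
theorem comp_seqComp_eq {W β : Type*} {h : Fin p → W → W} {c : W → β}
    (hc : ∀ m w, c (h m w) = c w) (w : W) : c (seqComp h w) = c w :=
  seqComp_induction (Q := fun f => ∀ w, c (f w) = c w) (fun _ => rfl)
    (fun _ f hg hf w => (hg (f w)).trans (hf w)) h hc w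

/-- If the flow time of every channel is invariant under the other channels, the flow times may
be evaluated at the initial point. -/
theorem seqComp_flow_time_eq {W : Type*} {Φ : Fin p → ℝ → W → W} {u : Fin p → W → ℝ}
    (hu : ∀ i j, i ≠ j → ∀ t w, u i (Φ j t w) = u i w) (w : W) :
    seqComp (fun m w => Φ m (u m w) w) w = seqComp (fun m => Φ m (u m w)) w := by
  induction p with
  | zero => simp only [seqComp_zero]
  | succ p ih =>
    simp only [seqComp_succ, comp_apply]
    -- The last flow time is evaluated after the earlier channels, which do not change it.
    rw [comp_seqComp_eq (c := u (Fin.last p)) (fun m z => hu _ _ (Fin.castSucc_lt_last m).ne' _ z),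
      ih (Φ := fun m => Φ m.castSucc) (u := fun m => u m.castSucc)
        (fun i j hij => hu _ _ (by simpa using hij))]

theorem comp_flow_eq {V : ∀ w : M, TangentSpace (𝓡 n) w}
    (hV : ContMDiff (𝓡 n) (𝓡 n).tangent ∞ (fun w => (⟨w, V w⟩ : TangentBundle (𝓡 n) M)))
    {δ : M → ℝ} (hδ : MDifferentiable (𝓡 n) 𝓘(ℝ, ℝ) δ) (h : ∀ w, differential δ w (V w) = 0)
    (t : ℝ) (w : M) : δ (flow V t w) = δ w := by
  have hd := fun t => hasDerivAt_comp_flow (t := t) (w := w) hV (hδ _)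
  have := is_const_of_deriv_eq_zero (fun t => (hd t).differentiableAt)
    (fun t => by rw [(hd t).deriv, h]) t 0
  simpa only [flow_zero hV] using this

end CommutingFlows

/-! ### From the gradient bound to a positive determinant -/

section Gradient

variable {n : ℕ} {W : Type*} [TopologicalSpace W] [ChartedSpace (EuclideanSpace ℝ (Fin n)) W]

/-- Cauchy–Schwarz in the Riemannian metric, as the gradient represents the differential. -/
theorem abs_differential_le [Bundle.RiemannianBundle (fun w : W => TangentSpace (𝓡 n) w)]
    (δ : W → ℝ) (w : W) (v : TangentSpace (𝓡 n) w) :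
    |differential δ w v| ≤ ‖grad (n := n) δ w‖ * ‖v‖ := by
  have : FiniteDimensional ℝ (TangentSpace (𝓡 n) w) :=
    inferInstanceAs (FiniteDimensional ℝ (EuclideanSpace ℝ (Fin n)))
  have : CompleteSpace (TangentSpace (𝓡 n) w) := FiniteDimensional.complete ℝ _
  have h : differential δ w v = inner ℝ (grad (n := n) δ w) v :=
    (InnerProductSpace.toDual_symm_apply (𝕜 := ℝ) (x := v) (y := differential δ w)).symm
  rw [h]
  exact abs_real_inner_le_norm _ _

theorem differential_comp {δ : W → ℝ} {w : W} (hδ : MDifferentiableAt (𝓡 n) 𝓘(ℝ, ℝ) δ w)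
    {g : ℝ → ℝ} (hg : DifferentiableAt ℝ g (δ w)) (v : TangentSpace (𝓡 n) w) :
    differential (fun w => g (δ w)) w v = deriv g (δ w) * differential δ w v := by
  have h := HasMFDerivAt.comp (g := g) (f := δ) w hg.hasFDerivAt.hasMFDerivAt hδ.hasMFDerivAt
  have h' : differential (fun w => g (δ w)) w = (fderiv ℝ g (δ w)).comp (differential δ w) :=
    h.mfderiv
  rw [h', ContinuousLinearMap.comp_apply, fderiv_eq_smul_deriv, smul_eq_mul, mul_comm]

/-- The chain rule and Cauchy–Schwarz give `|du(V)| ≤ |g'| L < 1` for `u = g ∘ δ`. The product form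
of the bound imposes nothing when `L = 0`. -/
theorem one_add_differential_pos
    [Bundle.RiemannianBundle (fun w : W => TangentSpace (𝓡 n) w)]
    {δ : W → ℝ} (hδ : MDifferentiable (𝓡 n) 𝓘(ℝ, ℝ) δ) {g : ℝ → ℝ} (hg : Differentiable ℝ g)
    {L : ℝ} (hL : ∀ w, ‖grad (n := n) δ w‖ ≤ L) (hgL : ∀ x, |deriv g x| * L < 1)
    {V : ∀ w : W, TangentSpace (𝓡 n) w} (hV : ∀ w, ‖V w‖ ≤ 1) (w : W) :
    0 < 1 + differential (fun w => g (δ w)) w (V w) := by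
  have h1 : |differential δ w (V w)| ≤ L := (abs_differential_le δ w (V w)).trans
    ((mul_le_of_le_one_right (norm_nonneg _) (hV w)).trans (hL w))
  have h2 : |differential (fun w => g (δ w)) w (V w)| < 1 := by
    rw [differential_comp (hδ w) (hg _), abs_mul]
    exact (mul_le_mul_of_nonneg_left h1 (abs_nonneg _)).trans_lt (hgL _)
  linarith [(abs_lt.1 h2).1]

end Gradient

end Deformation

/-! ### Assembly of the proposition -/

theorem proposition2 {n p : ℕ}
    {S : Type*} [TopologicalSpace S] [CompactSpace S] [T2Space S]
    [ChartedSpace (EuclideanSpace ℝ (Fin n)) S] [IsManifold (𝓡 n) ∞ S]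
    {W : Type*} [TopologicalSpace W] [CompactSpace W] [T2Space W]
    [ChartedSpace (EuclideanSpace ℝ (Fin n)) W] [IsManifold (𝓡 n) ∞ W]
    [Bundle.RiemannianBundle (fun w : W => TangentSpace (𝓡 n) w)]
    [IsContMDiffRiemannianBundle (𝓡 n) ∞ (EuclideanSpace ℝ (Fin n))
      (fun w : W => TangentSpace (𝓡 n) w)]
    (oS : Deformation.ManifoldOrientation n S) (oW : Deformation.ManifoldOrientation n W)
    -- the baseline deformation
    (f₀ : S → W) (hf₀ : Deformation.IsOrientedDiffeo oS oW f₀)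
    -- smooth commuting velocity fields of speed at most one
    (V : Fin p → ∀ w : W, TangentSpace (𝓡 n) w)
    (hV : ∀ m, ContMDiff (𝓡 n) (𝓡 n).tangent ∞
      (fun w => (⟨w, V m w⟩ : TangentBundle (𝓡 n) W)))
    (hcomm : ∀ i j, i ≠ j → VectorField.mlieBracket (𝓡 n) (V i) (V j) = 0)
    (hVnorm : ∀ m w, ‖V m w‖ ≤ 1)
    -- baseline and shifted covariates, and the gradient bounds of the shifts
    (τ₀ τ : Fin p → W → ℝ)
    (hτ₀ : ∀ m, MDifferentiable (𝓡 n) 𝓘(ℝ, ℝ) (τ₀ m))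
    (hτ : ∀ m, MDifferentiable (𝓡 n) 𝓘(ℝ, ℝ) (τ m))
    (L : Fin p → ℝ)
    (hL : ∀ m, IsLUB (Set.range fun w : W => ‖Deformation.grad (n := n) (τ m - τ₀ m) w‖) (L m))
    -- the link functions
    (g : Fin p → ℝ → ℝ) (hgcont : ∀ m, Continuous (g m))
    (hgmono : ∀ m, StrictMono (g m) ∨ StrictAnti (g m))
    (hgdiff : ∀ m, Differentiable ℝ (g m))
    (hgbound : ∀ m x, |deriv (g m) x| * L m < 1) :
    -- every channel deforms `W` validly
    (∀ m, Deformation.IsOrientedDifferentiableIso oW oW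
      (Deformation.channelDeformation (V m) (g m) (τ m - τ₀ m))) ∧
    -- so does the total deformation
    Deformation.IsOrientedDifferentiableIso oS oW
      (Deformation.totalDeformation V g (fun m => τ m - τ₀ m) f₀) ∧
    -- for `C¹` data these are `C¹` diffeomorphisms
    (∀ m, ContDiff ℝ 1 (g m) → ContMDiff (𝓡 n) 𝓘(ℝ, ℝ) 1 (τ₀ m) →
      ContMDiff (𝓡 n) 𝓘(ℝ, ℝ) 1 (τ m) →
      Deformation.IsOrientedDiffeo oW oW
        (Deformation.channelDeformation (V m) (g m) (τ m - τ₀ m))) ∧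
    ((∀ m, ContDiff ℝ 1 (g m)) → (∀ m, ContMDiff (𝓡 n) 𝓘(ℝ, ℝ) 1 (τ₀ m)) →
      (∀ m, ContMDiff (𝓡 n) 𝓘(ℝ, ℝ) 1 (τ m)) →
      Deformation.IsOrientedDiffeo oS oW
        (Deformation.totalDeformation V g (fun m => τ m - τ₀ m) f₀)) ∧
    -- with the flow amounts of any location `w`, the joint exponential factorizes exactly
    (∀ w : W, Deformation.vexp (∑ m, g m (τ m w - τ₀ m w) • V m) =
      Deformation.seqComp (fun m => Deformation.vexp (g m (τ m w - τ₀ m w) • V m))) ∧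
    -- if no channel changes the shift of another one, the joint deformation is the total one
    ((∀ i j, i ≠ j → ∀ w, mfderiv (𝓡 n) 𝓘(ℝ, ℝ) (τ i - τ₀ i) w (V j w) = 0) →
      ∀ s : S, Deformation.vexp
          (∑ m, g m (τ m (f₀ s) - τ₀ m (f₀ s)) • V m) (f₀ s) =
        Deformation.totalDeformation V g (fun m => τ m - τ₀ m) f₀ s) := by

  have hδ : ∀ m, MDifferentiable (𝓡 n) 𝓘(ℝ, ℝ) (τ m - τ₀ m) := fun m => (hτ m).sub (hτ₀ m)
  have hu : ∀ m, MDifferentiable (𝓡 n) 𝓘(ℝ, ℝ) (fun w => g m ((τ m - τ₀ m) w)) := fun m w =>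
    (hgdiff m _).mdifferentiableAt.comp w (hδ m w)
  have hpos : ∀ m w, 0 < 1 + Deformation.differential (fun w => g m ((τ m - τ₀ m) w)) w (V m w) :=
    fun m => Deformation.one_add_differential_pos (hδ m) (hgdiff m)
      (fun w => (hL m).1 (Set.mem_range_self w)) (hgbound m) (hVnorm m)
  have hch : ∀ m, Deformation.IsOrientedDifferentiableIso oW oW
      (Deformation.channelDeformation (V m) (g m) (τ m - τ₀ m)) := fun m =>
    -- By definition `channelDeformation` is `flow` with the variable time `g m (δ w)`.
    Deformation.isOrientedDifferentiableIso_flow_time (hV m) oW (hu m) (hpos m)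
  have hdiffeo : ∀ m, ContDiff ℝ 1 (g m) → ContMDiff (𝓡 n) 𝓘(ℝ, ℝ) 1 (τ₀ m) →
      ContMDiff (𝓡 n) 𝓘(ℝ, ℝ) 1 (τ m) →
      Deformation.IsOrientedDiffeo oW oW
        (Deformation.channelDeformation (V m) (g m) (τ m - τ₀ m)) := fun m hg1 h0 h1 =>
    (hch m).isOrientedDiffeo (Deformation.contMDiff_flow_time (hV m)
      (hg1.contMDiff.comp (h1.sub h0)))
  refine ⟨hch, ?_, hdiffeo, fun hg1 h0 h1 => ?_, fun w => ?_, fun hinv s => ?_⟩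
  · exact (Deformation.seqComp_induction Deformation.isOrientedDiffeo_id.isOrientedDifferentiableIso
      (fun _ _ => Deformation.IsOrientedDifferentiableIso.comp) _ hch).comp
      hf₀.isOrientedDifferentiableIso
  · exact (Deformation.seqComp_induction Deformation.isOrientedDiffeo_id
      (fun _ _ => Deformation.IsOrientedDiffeo.comp) _
      fun m => hdiffeo m (hg1 m) (h0 m) (h1 m)).comp hf₀
  · exact Deformation.vexp_sum_eq_seqComp hV hcomm _
  -- The joint exponential splits with amounts frozen at `f₀ s`. By `hinv` each shift is constant
  -- along the other flow lines, so the frozen amounts are the ones met on the way.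
  · rw [Deformation.vexp_sum_eq_seqComp hV hcomm]
    exact (Deformation.seqComp_flow_time_eq (Φ := fun m => Deformation.flow (V m))
      (u := fun m w => g m ((τ m - τ₀ m) w)) (fun i j hij t w => congrArg (g i)
        (Deformation.comp_flow_eq (hV j) (hδ i) (fun w => hinv i j hij w) t w)) (f₀ s)).symm
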